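/- A hypergraph has a finite nonempty vertex set and a set of edges, each edge being a set of at least two vertices; its order is its number of vertices. The adjacency matrix $\mathcal A_{\mathcal G}$ of a hypergraph $\mathcal G$ has entries $(\mathcal A_{\mathcal G})_{ij}=\sum_{e\ni i,j}\frac{1}{|e|-1}$ for distinct vertices $i\ne j$, the sum running over the edges $e$ that contain both $i$ and $j$, and $(\mathcal A_{\mathcal G})_{ii}=0$. The spectral radius $\rho(\mathcal G)$ is the maximum modulus of the eigenvalues of $\mathcal A_{\mathcal G}$. For $k\ge 3$, the $k$-th power $T^k$ of a finite ordinary tree $T$ is the $k$-uniform hypergraph obtained from $T$ by adding to each edge of $T$ its own $k-2$ new vertices (new vertices of different edges being different). For $m\ge 0$ and $n=m(k-1)+1$: - $\mathcal P(n,k)$ is the $k$-uniform hyperpath of order $n$, with $m$ edges: its vertices are $0,1,\dots,n-1$ and its edges are $\{i(k-1),\,i(k-1)+1,\,\dots,\,(i+1)(k-1)\}$ for $0\le i<m$; - $\mathcal S^{*}(n,k)$ is the $k$-uniform superstar of order $n$, with $m$ edges: its vertices are $0,1,\dots,n-1$ and its edges are $\{0\}\cup\{i(k-1)+1,\,\dots,\,(i+1)(k-1)\}$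 for $0\le i<m$. Corollary 1.4. Let $k\ge 3$, let $T$ be a finite ordinary tree, and let $n$ be the order of $T^k$ (so $n=m(k-1)+1$, where $m$ is the number of edges of $T$). Then (1) $\rho(T^k)\le\rho(\mathcal S^{*}(n,k))$, with equality if and only if $T^k\cong\mathcal S^{*}(n,k)$; (2) $\rho(\mathcal P(n,k))\le\rho(T^k)$, with equality if and only if $T^k\cong\mathcal P(n,k)$. -/

import Mathlib

namespace Hypergraph

/-- The adjacency matrix of a hypergraph `H`: for distinct vertices `i`, `j` the entry is the sum of
`1 / (|e| - 1)` over all edges `e` containing both `i` and `j`; the diagonal entries are `0`. -/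
noncomputable def adjMatrix {α : Type*} (H : Hypergraph α) :
    Matrix H.vertexSet H.vertexSet ℝ := by
  classical
  exact Matrix.of fun i j =>
    if i = j then 0
    else ∑ᶠ e ∈ {e ∈ H.edgeSet | (i : α) ∈ e ∧ (j : α) ∈ e}, 1 / ((e.ncard : ℝ) - 1)

/-- The spectral radius of a hypergraph with finitely many vertices: the maximum modulus of the
(complex) eigenvalues of its adjacency matrix. The spectrum of a matrix is finite, so this
`ℝ≥0∞`-valued supremum is a maximum and is finite. -/
noncomputable def rho {α : Type*} (H : Hypergraph α) [Finite H.vertexSet] : ENNReal := by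
  classical
  exact
    letI : Fintype H.vertexSet := Fintype.ofFinite H.vertexSet
    spectralRadius ℂ (H.adjMatrix.map (fun x : ℝ => (x : ℂ)))

/-- Two hypergraphs are isomorphic if some bijection of their vertex sets carries the edges of the
first exactly onto the edges of the second. -/
def Isomorphic {α β : Type*} (G : Hypergraph α) (H : Hypergraph β) : Prop :=
  ∃ f : G.vertexSet ≃ H.vertexSet, ∀ e : Set G.vertexSet,
    Subtype.val '' e ∈ G.edgeSet ↔ Subtype.val '' (f '' e) ∈ H.edgeSet

/-- The `k`-uniform hyperpath of order `n` (for `n = m (k - 1) + 1`, with `m` edges), on the vertices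
`0, …, n - 1`: the `i`-th edge, `i < m`, consists of the `k` consecutive vertices from `i (k - 1)`
to `(i + 1) (k - 1)`. So consecutive edges share exactly one vertex, and other edges are disjoint. -/
def hyperpath (n k : ℕ) : Hypergraph (Fin n) where
  vertexSet := Set.univ
  edgeSet := {e | ∃ i < (n - 1) / (k - 1),
    e = {v : Fin n | i * (k - 1) ≤ v.val ∧ v.val ≤ (i + 1) * (k - 1)}}
  subset_vertexSet_of_mem_edgeSet' := fun e _ => Set.subset_univ e

/-- The `k`-uniform superstar of order `n` (for `n = m (k - 1) + 1`, with `m` edges), on the vertices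
`0, …, n - 1`: the `i`-th edge, `i < m`, consists of the centre `0` and of the `k - 1` vertices from
`i (k - 1) + 1` to `(i + 1) (k - 1)`. So any two distinct edges share exactly the vertex `0`. -/
def superstar (n k : ℕ) : Hypergraph (Fin n) where
  vertexSet := Set.univ
  edgeSet := {e | ∃ i < (n - 1) / (k - 1),
    e = {v : Fin n | v.val = 0 ∨ (i * (k - 1) < v.val ∧ v.val ≤ (i + 1) * (k - 1))}}
  subset_vertexSet_of_mem_edgeSet' := fun e _ => Set.subset_univ e

/-- The `k`-th power of an ordinary graph `G`: every edge `e` of `G` is enlarged by `k - 2` new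
vertices `(e, 0), …, (e, k - 3)` of its own. -/
def graphPower {V : Type*} (G : SimpleGraph V) (k : ℕ) :
    Hypergraph (V ⊕ (G.edgeSet × Fin (k - 2))) where
  vertexSet := Set.univ
  edgeSet := Set.range fun e : G.edgeSet =>
    Sum.inl '' {v : V | v ∈ e.val} ∪ Sum.inr '' {p : G.edgeSet × Fin (k - 2) | p.1 = e}
  subset_vertexSet_of_mem_edgeSet' := fun e _ => Set.subset_univ e

end Hypergraph

/-! A positive eigenvector of the adjacency matrix of T^k belongs to the spectral radius, which is
written l/(k-1). All new vertices of an edge have the same value, so they can be eliminated. On V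
this leaves l·x_u = Σ_{v∼u} (a·x_u + b·x_v) with a = `pull k l` = (k-2)/(l-k+3) and b = 1+a: an
eigenvalue equation for aD+bA whose coefficients depend on l. Since a decreases with l, strict
positive sub- and supersolutions at m still bound l (`lt_of_subsolution`, `lt_of_supersolution`).
Each bound then follows from a test vector on the star or path with N = |V| vertices, built from the
l of T.

Star: at a vertex u where x is largest, a neighbour v contributes at most deg v times the
contribution a+b²/(l-a) of a pendant vertex, and the degrees of the neighbours add up to at most
N-1. Hence l < (N-1)(a+b²/(l-a)) unless T is a star (`eigenvalue_lt_of_not_star`), which says that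
the natural vector on the star is a strict subsolution.

Path: root T at a leaf. The branch at v pulls on its parent with q_v = a+b²/(l-a-Σq_w), w running
over the children of v. A hanging path obeys the same recursion (`pathPull`), and two paths at one
vertex pull strictly more than one path of their total length (`pathPull.add_lt`). By induction
every branch pulls at least as much as a path of its size. The branch at the root pulls exactly l,
so the path's pull is at most l, with equality only if T is a path; a strict inequality makes the
path's vector a strict supersolution.

Strictness outside the extremal trees settles equality; explicit labellings identify the powers of
stars and paths with the superstar and hyperpath. -/

open Matrix Finset

/-! ### Perron vectors of nonnegative symmetric matrices -/

/-- A symmetric matrix with nonnegative entries has a nonzero nonnegative eigenvector. -/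
theorem Matrix.exists_nonneg_eigenvector {ι : Type*} [Fintype ι] [Nonempty ι]
    (A : Matrix ι ι ℝ) (hA : A.IsSymm) (h0 : ∀ i j, 0 ≤ A i j) :
    ∃ (l : ℝ) (x : ι → ℝ), (∀ i, 0 ≤ x i) ∧ x ≠ 0 ∧ A *ᵥ x = l • x := by
  classical
  let T : EuclideanSpace ℝ ι →L[ℝ] EuclideanSpace ℝ ι := Matrix.toEuclideanCLM (𝕜 := ℝ) A
  have hT : IsSelfAdjoint T := by
    have : IsSelfAdjoint A := by
      rw [isSelfAdjoint_iff, star_eq_conjTranspose, conjTranspose_eq_transpose_of_trivial]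
      exact hA
    exact this.map _
  have hTx : ∀ (x : EuclideanSpace ℝ ι) i, T x i = ∑ j, A i j * x j := fun x i => rfl
  have hQ : ∀ x : EuclideanSpace ℝ ι, T.reApplyInnerSelf x = ∑ i, ∑ j, A i j * x j * x i := by
    intro x
    rw [ContinuousLinearMap.reApplyInnerSelf_apply, PiLp.inner_apply]
    simp [hTx, Finset.mul_sum, mul_comm]
  obtain ⟨i0⟩ := ‹Nonempty ι›
  have hne : (Metric.sphere (0 : EuclideanSpace ℝ ι) 1).Nonempty :=
    ⟨EuclideanSpace.single i0 1, by simp⟩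
  obtain ⟨y, hy, hmax⟩ := (isCompact_sphere (0 : EuclideanSpace ℝ ι) 1).exists_isMaxOn hne
    (T.reApplyInnerSelf_continuous.continuousOn)
  -- Absolute values keep the norm and cannot decrease a quadratic form with nonnegative
  -- coefficients, so `x` is again a maximiser on the sphere, hence an eigenvector.
  let x : EuclideanSpace ℝ ι := WithLp.toLp 2 fun i => |y i|
  have hx : ‖x‖ = 1 := by
    rw [← mem_sphere_zero_iff_norm.mp hy, EuclideanSpace.norm_eq, EuclideanSpace.norm_eq]
    simp [x]
  have hx0 : x ≠ 0 := by
    rintro h; rw [h] at hx; simp at hx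
  have hle : T.reApplyInnerSelf y ≤ T.reApplyInnerSelf x := by
    rw [hQ, hQ]
    refine Finset.sum_le_sum fun i _ => Finset.sum_le_sum fun j _ => ?_
    have : y j * y i ≤ |y j| * |y i| := by rw [← abs_mul]; exact le_abs_self _
    simpa [x, mul_assoc] using mul_le_mul_of_nonneg_left this (h0 i j)
  have hmax' : IsMaxOn T.reApplyInnerSelf (Metric.sphere 0 ‖x‖) x := by
    rw [hx]
    intro z hz
    exact (hmax hz).trans hle
  have hev := hT.hasEigenvector_of_isMaxOn hx0 hmax'
  refine ⟨⨆ z : {z : EuclideanSpace ℝ ι // z ≠ 0}, T.rayleighQuotient z, fun i => x i,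
    fun i => abs_nonneg _, fun h => hx0 ?_, ?_⟩
  · ext i; exact congrFun h i
  · ext i
    have := congrArg (fun z : EuclideanSpace ℝ ι => z i) hev.apply_eq_smul
    exact this

/-- A positive eigenvector of a nonnegative symmetric matrix belongs to the spectral radius. -/
theorem Matrix.spectralRadius_eq_of_pos_eigenvector {ι : Type*} [Fintype ι] [DecidableEq ι]
    [Nonempty ι] (A : Matrix ι ι ℝ) (hA : A.IsSymm) (h0 : ∀ i j, 0 ≤ A i j) {l : ℝ} {x : ι → ℝ}
    (hx : ∀ i, 0 < x i) (h : A *ᵥ x = l • x) :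
    spectralRadius ℂ (A.map (fun t : ℝ => (t : ℂ))) = ENNReal.ofReal l := by
  have hAx : ∀ i, ∑ j, A i j * x j = l * x i := fun i => congrFun h i
  have hl : 0 ≤ l := by
    obtain ⟨i⟩ := ‹Nonempty ι›
    have h1 : 0 ≤ l * x i := by
      rw [← hAx]; exact Finset.sum_nonneg fun j _ => mul_nonneg (h0 i j) (hx j).le
    exact nonneg_of_mul_nonneg_left h1 (hx i)
  have key : ∀ μ ∈ spectrum ℂ (A.map (fun t : ℝ => (t : ℂ))), ‖μ‖ ≤ l := by
    intro μ hμ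
    rw [← spectrum_toLin', ← Module.End.hasEigenvalue_iff_mem_spectrum] at hμ
    obtain ⟨v, hv⟩ := hμ.exists_hasEigenvector
    have hv1 : ∀ i, ∑ j, (A i j : ℂ) * v j = μ * v i := fun i => congrFun hv.apply_eq_smul i
    have hb : ∀ i, ‖μ‖ * ‖v i‖ ≤ ∑ j, A i j * ‖v j‖ := by
      intro i
      rw [← norm_mul, ← hv1]
      refine (norm_sum_le _ _).trans (le_of_eq (Finset.sum_congr rfl fun j _ => ?_))
      rw [norm_mul, Complex.norm_real, Real.norm_of_nonneg (h0 i j)]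
    -- Pairing `hb` with `x` and moving `A` onto `x` by symmetry bounds `‖μ‖` by `l`, once this
    -- pairing is known to be positive.
    have hS : 0 < ∑ i, x i * ‖v i‖ := by
      obtain ⟨i, hi⟩ : ∃ i, v i ≠ 0 := by
        by_contra! hc
        exact hv.2 (funext hc)
      exact Finset.sum_pos' (fun i _ => mul_nonneg (hx i).le (norm_nonneg _))
        ⟨i, Finset.mem_univ _, mul_pos (hx i) (norm_pos_iff.mpr hi)⟩
    refine le_of_mul_le_mul_right ?_ hS
    calc ‖μ‖ * ∑ i, x i * ‖v i‖ = ∑ i, x i * (‖μ‖ * ‖v i‖) := by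
          rw [Finset.mul_sum]; exact Finset.sum_congr rfl fun i _ => by ring
      _ ≤ ∑ i, x i * ∑ j, A i j * ‖v j‖ :=
          Finset.sum_le_sum fun i _ => mul_le_mul_of_nonneg_left (hb i) (hx i).le
      _ = ∑ j, (∑ i, A j i * x i) * ‖v j‖ := by
          simp_rw [Finset.mul_sum, Finset.sum_mul]
          rw [Finset.sum_comm]
          refine Finset.sum_congr rfl fun i _ => Finset.sum_congr rfl fun j _ => ?_
          rw [hA.apply]; ring
      _ = l * ∑ i, x i * ‖v i‖ := by
          rw [Finset.mul_sum]; exact Finset.sum_congr rfl fun i _ => by rw [hAx]; ring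
  have hmem : (l : ℂ) ∈ spectrum ℂ (A.map (fun t : ℝ => (t : ℂ))) := by
    rw [← spectrum_toLin', ← Module.End.hasEigenvalue_iff_mem_spectrum]
    refine Module.End.hasEigenvalue_of_hasEigenvector (x := fun i => (x i : ℂ)) ⟨?_, ?_⟩
    · rw [Module.End.mem_eigenspace_iff]
      ext i
      change ∑ j, (A i j : ℂ) * x j = l * x i
      exact_mod_cast hAx i
    · intro hc
      obtain ⟨i⟩ := ‹Nonempty ι›
      have := congrFun hc i
      simp only [Pi.zero_apply, Complex.ofReal_eq_zero] at this
      exact (hx i).ne' this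
  rw [spectralRadius]
  apply le_antisymm
  · refine iSup₂_le fun μ hμ => ?_
    rw [← enorm_eq_nnnorm, ← ofReal_norm]
    exact ENNReal.ofReal_le_ofReal (key μ hμ)
  · refine le_trans (le_of_eq ?_) (le_iSup₂ (l : ℂ) hmem)
    rw [← enorm_eq_nnnorm, ← ofReal_norm, Complex.norm_real, Real.norm_of_nonneg hl]

/-! ### Isomorphism invariance and adjacency matrices of uniform hypergraphs -/

namespace Hypergraph

theorem Isomorphic.rho_eq {α β : Type*} {G : Hypergraph α} {H : Hypergraph β}
    [Finite G.vertexSet] [Finite H.vertexSet] (h : G.Isomorphic H) : G.rho = H.rho := by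
  classical
  obtain ⟨f, hf⟩ := h
  have hG : ∀ e ∈ G.edgeSet, Subtype.val '' (Subtype.val ⁻¹' e : Set G.vertexSet) = e := by
    intro e he
    rw [Subtype.image_preimage_coe, Set.inter_eq_right]
    exact G.subset_vertexSet_of_mem_edgeSet' he
  have hH : ∀ e ∈ H.edgeSet, Subtype.val '' (Subtype.val ⁻¹' e : Set H.vertexSet) = e := by
    intro e he
    rw [Subtype.image_preimage_coe, Set.inter_eq_right]
    exact H.subset_vertexSet_of_mem_edgeSet' he
  have hadj : ∀ i j, G.adjMatrix i j = H.adjMatrix (f i) (f j) := by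
    intro i j
    simp only [adjMatrix, Matrix.of_apply, f.injective.eq_iff]
    split_ifs with hij
    · rfl
    refine finsum_mem_eq_of_bijOn
      (fun e => Subtype.val '' (f '' (Subtype.val ⁻¹' e : Set G.vertexSet))) ⟨?_, ?_, ?_⟩ ?_
    · rintro e ⟨he, hi, hj⟩
      refine ⟨(hf _).1 (by rwa [hG e he]), ?_, ?_⟩
      · exact ⟨f i, ⟨i, hi, rfl⟩, rfl⟩
      · exact ⟨f j, ⟨j, hj, rfl⟩, rfl⟩
    · rintro e ⟨he, -, -⟩ e' ⟨he', -, -⟩ hee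
      have h1 := f.injective.image_injective (Subtype.val_injective.image_injective hee)
      rw [← hG e he, ← hG e' he', h1]
    · rintro e ⟨he, hi, hj⟩
      have h1 : f '' (f ⁻¹' (Subtype.val ⁻¹' e)) = (Subtype.val ⁻¹' e : Set H.vertexSet) :=
        Set.image_preimage_eq _ f.surjective
      refine ⟨Subtype.val '' (f ⁻¹' (Subtype.val ⁻¹' e)), ⟨?_, ?_, ?_⟩, ?_⟩
      · rw [hf, h1, hH e he]; exact he
      · exact ⟨i, hi, rfl⟩
      · exact ⟨j, hj, rfl⟩
      · dsimp only
        rw [Set.preimage_image_eq _ Subtype.val_injective, h1, hH e he]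
    · rintro e ⟨he, -, -⟩
      rw [Set.ncard_image_of_injective _ Subtype.val_injective,
        Set.ncard_image_of_injective _ f.injective]
      conv_lhs => rw [← hG e he, Set.ncard_image_of_injective _ Subtype.val_injective]
  let : Fintype G.vertexSet := Fintype.ofFinite _
  let : Fintype H.vertexSet := Fintype.ofFinite _
  have key : H.adjMatrix.map (fun x : ℝ => (x : ℂ)) =
      Matrix.reindexAlgEquiv ℂ ℂ f (G.adjMatrix.map (fun x : ℝ => (x : ℂ))) := by
    ext i j
    simp [hadj]
  simp only [rho, spectralRadius]
  rw [key, AlgEquiv.spectrum_eq]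

/-- Hypergraphs on all of `α` and `β` are isomorphic if a bijection carries an enumeration of the
edges of the first to an enumeration of the edges of the second. -/
theorem isomorphic_of_bijective {α β ι κ : Type*} {G : Hypergraph α} {H : Hypergraph β}
    (hG : ∀ a, a ∈ G.vertexSet) (hH : ∀ b, b ∈ H.vertexSet) (E : ι → Set α) (F : κ → Set β)
    (hE : G.edgeSet = Set.range E) (hF : H.edgeSet = Set.range F) (f : α → β)
    (hf : Function.Bijective f) (s : ι → κ) (hs : Function.Surjective s)
    (h : ∀ i, f '' E i = F (s i)) : G.Isomorphic H := by
  refine ⟨(Equiv.subtypeUnivEquiv hG).trans ((Equiv.ofBijective f hf).trans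
    (Equiv.subtypeUnivEquiv hH).symm), fun e => ?_⟩
  rw [hE, hF]
  have h1 : Subtype.val '' (((Equiv.subtypeUnivEquiv hG).trans ((Equiv.ofBijective f hf).trans
    (Equiv.subtypeUnivEquiv hH).symm)) '' e) = f '' (Subtype.val '' e) := by
    rw [Set.image_image, Set.image_image]; rfl
  rw [h1]
  constructor
  · rintro ⟨i, hi⟩; exact ⟨s i, by rw [← h, hi]⟩
  · rintro ⟨j, hj⟩
    obtain ⟨i, rfl⟩ := hs j
    exact ⟨i, hf.injective.image_injective (by rw [h, hj])⟩

open Classical in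
theorem adjMatrix_apply_of_uniform {α ι : Type*} [Fintype ι] (H : Hypergraph α) (E : ι → Set α)
    (hE : Function.Injective E) (hr : H.edgeSet = Set.range E) {k : ℕ} (hk : ∀ e, (E e).ncard = k)
    (i j : H.vertexSet) :
    H.adjMatrix i j = if i = j then 0 else
      ∑ e, if (i : α) ∈ E e ∧ (j : α) ∈ E e then 1 / ((k : ℝ) - 1) else 0 := by
  simp only [adjMatrix, Matrix.of_apply]
  split_ifs with hij
  · rfl
  have h1 : {e ∈ H.edgeSet | (i : α) ∈ e ∧ (j : α) ∈ e} =
      E '' {e | (i : α) ∈ E e ∧ (j : α) ∈ E e} := by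
    rw [hr]; ext s; constructor
    · rintro ⟨⟨e, rfl⟩, h⟩; exact ⟨e, h, rfl⟩
    · rintro ⟨e, h, rfl⟩; exact ⟨⟨e, rfl⟩, h⟩
  rw [h1, finsum_mem_image hE.injOn, finsum_mem_def, finsum_eq_sum_of_fintype]
  refine Finset.sum_congr rfl fun e _ => ?_
  simp [Set.indicator_apply, hk]

-- Grouping the product by edges makes the edge totals of `z` the natural unknowns; these are what
-- the elimination of the new vertices uses.
open Classical in
theorem adjMatrix_mulVec_of_uniform {α ι : Type*} [Fintype ι] [Fintype α] (H : Hypergraph α)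
    [Fintype H.vertexSet] (hV : ∀ a, a ∈ H.vertexSet) (E : ι → Set α)
    (hE : Function.Injective E) (hr : H.edgeSet = Set.range E) {k : ℕ} (hk : ∀ e, (E e).ncard = k)
    (z : α → ℝ) (i : H.vertexSet) :
    (H.adjMatrix *ᵥ fun j => z j) i =
      (1 / ((k : ℝ) - 1)) * ∑ e, if (i : α) ∈ E e then (∑ j, if j ∈ E e then z j else 0) - z i
        else 0 := by
  have h1 : (H.adjMatrix *ᵥ fun j => z j) i = ∑ j : α, (if (i : α) = j then 0 else
      ∑ e, if (i : α) ∈ E e ∧ j ∈ E e then 1 / ((k : ℝ) - 1) else 0) * z j := by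
    rw [← (Equiv.subtypeUnivEquiv hV).sum_comp]
    refine Finset.sum_congr rfl fun j _ => ?_
    change H.adjMatrix i j * z j = _
    rw [adjMatrix_apply_of_uniform H E hE hr hk]
    simp [Subtype.ext_iff]
  rw [h1, Finset.mul_sum]
  have h2 : ∀ j : α, (if (i : α) = j then 0 else
      ∑ e, if (i : α) ∈ E e ∧ j ∈ E e then 1 / ((k : ℝ) - 1) else 0) * z j =
      ∑ e, if (i : α) = j then 0 else
        if (i : α) ∈ E e ∧ j ∈ E e then (1 / ((k : ℝ) - 1)) * z j else 0 := by
    intro j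
    split_ifs with h
    · simp
    · rw [Finset.sum_mul]; simp only [ite_mul, zero_mul]
  simp_rw [h2]
  rw [Finset.sum_comm]
  refine Finset.sum_congr rfl fun e _ => ?_
  split_ifs with hi
  · have : (∑ j, if j ∈ E e then z j else 0) - z i =
        ∑ j, ((if j ∈ E e then z j else 0) - if (i : α) = j then z j else 0) := by
      rw [Finset.sum_sub_distrib]; simp
    rw [this, Finset.mul_sum]
    refine Finset.sum_congr rfl fun j _ => ?_
    by_cases hj : (i : α) = j
    · subst hj; simp [hi]
    · simp [hj, hi]
  · simp [hi]

/-! ### Edges of the power of a graph -/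

variable {V : Type*} (G : SimpleGraph V) (k : ℕ)

/-- The edge of `graphPower G k` coming from the edge `e` of `G`. -/
def powerEdge (e : G.edgeSet) : Set (V ⊕ (G.edgeSet × Fin (k - 2))) :=
  Sum.inl '' {v : V | v ∈ e.val} ∪ Sum.inr '' {p : G.edgeSet × Fin (k - 2) | p.1 = e}

@[simp] theorem inl_mem_powerEdge {e : G.edgeSet} {v : V} :
    Sum.inl v ∈ powerEdge G k e ↔ v ∈ e.val := by simp [powerEdge]

@[simp] theorem inr_mem_powerEdge {e : G.edgeSet} {p : G.edgeSet × Fin (k - 2)} :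
    Sum.inr p ∈ powerEdge G k e ↔ p.1 = e := by simp [powerEdge]

theorem powerEdge_injective : Function.Injective (powerEdge G k) := by
  intro e e' h
  refine Subtype.ext (Sym2.ext fun v => ?_)
  rw [← inl_mem_powerEdge G k, h, inl_mem_powerEdge]

theorem graphPower_edgeSet : (graphPower G k).edgeSet = Set.range (powerEdge G k) := rfl

open Classical in
theorem sum_powerEdge [Fintype V] [Fintype G.edgeSet] (z : V ⊕ (G.edgeSet × Fin (k - 2)) → ℝ)
    {u v : V} (h : G.Adj u v) :
    (∑ j, if j ∈ powerEdge G k ⟨s(u, v), h⟩ then z j else 0) =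
      z (.inl u) + z (.inl v) + ∑ i, z (.inr (⟨s(u, v), h⟩, i)) := by
  rw [Fintype.sum_sum_type, Fintype.sum_prod_type]
  congr 1
  · simp only [inl_mem_powerEdge, Sym2.mem_iff]
    rw [← Finset.sum_filter, ← Finset.sum_pair h.ne (f := fun v => z (.inl v))]
    congr 1
    ext; simp
  · simp only [inr_mem_powerEdge]
    rw [Finset.sum_eq_single ⟨s(u, v), h⟩]
    · simp
    · intro b _ hb; simp [hb]
    · simp

theorem ncard_powerEdge [Finite V] (hk : 3 ≤ k) (e : G.edgeSet) : (powerEdge G k e).ncard = k := by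
  classical
  let := Fintype.ofFinite V
  obtain ⟨⟨u, v⟩, h⟩ := e
  have := sum_powerEdge G k (fun _ => 1) (u := u) (v := v) h
  rw [Set.ncard_eq_toFinset_card']
  have h2 : ((powerEdge G k ⟨s(u, v), h⟩).toFinset.card : ℝ) = k := by
    rw [← Set.filter_mem_univ_eq_toFinset, Finset.card_filter]
    push_cast
    rw [this]
    simp [Nat.cast_sub (show 2 ≤ k by lia)]
    ring
  exact_mod_cast h2

open Classical in
theorem sum_edges_at [Fintype V] [Fintype G.edgeSet] (F : G.edgeSet → ℝ) (u : V) :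
    (∑ e : G.edgeSet, if u ∈ e.val then F e else 0) =
      ∑ v, if h : G.Adj u v then F ⟨s(u, v), h⟩ else 0 := by
  symm
  rw [← Finset.sum_filter, ← Finset.sum_filter_of_ne (p := fun v => G.Adj u v)
    (by intro v _ h; by_contra hc; simp [hc] at h)]
  refine Finset.sum_bij (fun v hv => ⟨s(u, v), (Finset.mem_filter.1 hv).2⟩) ?_ ?_ ?_ ?_
  · intro v hv; simp
  · intro v hv w hw h
    simpa only [Sym2.congr_right] using congrArg Subtype.val h
  · rintro ⟨e, he⟩ h
    obtain ⟨w, rfl⟩ := (Finset.mem_filter.1 h).2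
    exact ⟨w, by simpa using he, rfl⟩
  · intro v hv
    rw [dif_pos (Finset.mem_filter.1 hv).2]

end Hypergraph

/-! ### Elimination of the new vertices and the comparison principle -/

namespace Hypergraph

variable {V : Type*} (G : SimpleGraph V) (k : ℕ)

/-- The weight that an edge of `G` puts on each of its ends when the new vertices of `graphPower G k`
are eliminated from the eigenvalue equation with eigenvalue `l / (k - 1)`. -/
noncomputable def pull (k : ℕ) (l : ℝ) : ℝ := ((k : ℝ) - 2) / (l - k + 3)

theorem pull_pos {k : ℕ} (hk : 3 ≤ k) {l : ℝ} (hl : (k : ℝ) - 3 < l) : 0 < pull k l := by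
  have : (3 : ℝ) ≤ k := by exact_mod_cast hk
  exact div_pos (by linarith) (by linarith)

theorem pull_anti {k : ℕ} (hk : 3 ≤ k) {l l' : ℝ} (hl : (k : ℝ) - 3 < l) (h : l ≤ l') :
    pull k l' ≤ pull k l := by
  have : (3 : ℝ) ≤ k := by exact_mod_cast hk
  exact div_le_div_of_nonneg_left (by linarith) (by linarith) (by linarith)

/-- The Perron vector of the power of a connected graph, restricted to the vertices of the graph. -/
theorem exists_perron [Fintype V] [Nontrivial V] [DecidableRel G.Adj] (hG : G.Connected)
    (hk : 3 ≤ k) : ∃ (l : ℝ) (x : V → ℝ), (k : ℝ) - 3 < l ∧ (∀ v, 0 < x v) ∧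
      (∀ u, l * x u = ∑ v ∈ G.neighborFinset u, (pull k l * x u + (1 + pull k l) * x v)) ∧
      (graphPower G k).rho = ENNReal.ofReal (l / ((k : ℝ) - 1)) := by
  classical
  have hk' : (3 : ℝ) ≤ k := by exact_mod_cast hk
  have hV : ∀ a, a ∈ (graphPower G k).vertexSet := fun a => Set.mem_univ a
  let : Fintype (graphPower G k).vertexSet := Fintype.ofFinite _
  have hmv := adjMatrix_mulVec_of_uniform (graphPower G k) hV (powerEdge G k)
    (powerEdge_injective G k) (graphPower_edgeSet G k) (ncard_powerEdge G k hk)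
  have happ := adjMatrix_apply_of_uniform (graphPower G k) (powerEdge G k)
    (powerEdge_injective G k) (graphPower_edgeSet G k) (ncard_powerEdge G k hk)
  have hsymm : (graphPower G k).adjMatrix.IsSymm := by
    ext i j
    rw [transpose_apply, happ, happ]
    by_cases hij : i = j
    · rw [if_pos hij, if_pos hij.symm]
    · rw [if_neg hij, if_neg (Ne.symm hij)]
      refine Finset.sum_congr rfl fun e _ => ?_
      split_ifs <;> tauto
  have hnn : ∀ i j, 0 ≤ (graphPower G k).adjMatrix i j := by
    intro i j
    rw [happ]
    split_ifs
    · rfl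
    · refine Finset.sum_nonneg fun e _ => ?_
      split_ifs
      · exact div_nonneg zero_le_one (by linarith)
      · rfl
  obtain ⟨v0⟩ := (inferInstance : Nonempty V)
  have : Nonempty (graphPower G k).vertexSet := ⟨⟨.inl v0, hV _⟩⟩
  obtain ⟨l0, z0, hz0, hzne, hz⟩ := Matrix.exists_nonneg_eigenvector _ hsymm hnn
  set z : V ⊕ (G.edgeSet × Fin (k - 2)) → ℝ := fun a => z0 ⟨a, hV a⟩ with hzdef
  have hznn : ∀ a, 0 ≤ z a := fun a => hz0 _
  set X : G.edgeSet → ℝ := fun e => ∑ j, if j ∈ powerEdge G k e then z j else 0 with hX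
  set l : ℝ := l0 * ((k : ℝ) - 1) with hl
  have heq : ∀ a, l * z a = ∑ e, if a ∈ powerEdge G k e then X e - z a else 0 := by
    intro a
    have h1 := hmv z ⟨a, hV a⟩
    have h2 := congrFun hz ⟨a, hV a⟩
    have h3 : (1 / ((k : ℝ) - 1)) * ∑ e, (if a ∈ powerEdge G k e then X e - z a else 0) =
      l0 * z a := by rw [← h1]; exact h2
    have : (k : ℝ) - 1 ≠ 0 := by linarith
    rw [hl]
    field_simp at h3
    linarith
  have hle : ∀ e a, a ∈ powerEdge G k e → z a ≤ X e := by
    intro e a ha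
    have := Finset.single_le_sum (f := fun j => if j ∈ powerEdge G k e then z j else 0)
      (fun j _ => by split_ifs; exacts [hznn j, le_rfl]) (Finset.mem_univ a)
    simpa only [if_pos ha] using this
  -- Where `z a = 0` the equation is a vanishing sum of nonnegative edge totals, so all of them
  -- vanish. Zeros thus spread along edges, and by connectedness over the whole hypergraph.
  have hzero : ∀ e a b, a ∈ powerEdge G k e → b ∈ powerEdge G k e → z a = 0 → z b = 0 := by
    intro e a b ha hb h0
    have h1 := heq a
    rw [h0, mul_zero, eq_comm, Finset.sum_eq_zero_iff_of_nonneg] at h1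
    · have h2 := h1 e (Finset.mem_univ _)
      rw [if_pos ha, sub_zero] at h2
      exact le_antisymm (h2 ▸ hle e b hb) (hznn b)
    · intro e _
      split_ifs with h
      · have := hle e a h; linarith
      · rfl
  have hpos : ∀ v, z (.inl v) ≠ 0 := by
    by_contra! hc
    obtain ⟨u, hu⟩ := hc
    have hall : ∀ v, z (.inl v) = 0 := by
      intro v
      obtain ⟨p⟩ := hG.preconnected u v
      induction p with
      | nil => exact hu
      | cons h p ih =>
        exact ih (hzero ⟨s(_, _), h⟩ (.inl _) (.inl _) (by simp) (by simp) hu)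
    refine hzne (funext fun a => ?_)
    obtain ⟨a | ⟨⟨⟨x, y⟩, h⟩, i⟩, _⟩ := a
    · exact hall a
    · exact hzero ⟨s(x, y), h⟩ (.inl x) _ (by simp) (by simp) (hall x)
  have hpos' : ∀ a, 0 < z a := by
    intro a
    refine lt_of_le_of_ne (hznn a) fun h => ?_
    obtain a | ⟨⟨⟨x, y⟩, hxy⟩, i⟩ := a
    · exact hpos a h.symm
    · exact hpos x (hzero ⟨s(x, y), hxy⟩ _ (.inl x) (by simp) (by simp) h.symm)
  -- A new vertex lies in one edge only, so its equation reads l·z = X_e - z.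
  have hnew : ∀ e i, (l + 1) * z (.inr (e, i)) = X e := by
    intro e i
    have h1 := heq (.inr (e, i))
    simp only [inr_mem_powerEdge] at h1
    rw [Finset.sum_ite_eq] at h1
    simp only [Finset.mem_univ, if_true] at h1
    linarith
  obtain ⟨w0, hw0⟩ := hG.preconnected.exists_adj_of_nontrivial v0
  have hl0 : 0 ≤ l := by
    have h1 : 0 ≤ l * z (.inl v0) := by
      rw [heq]
      refine Finset.sum_nonneg fun e _ => ?_
      split_ifs with h
      · have := hle e _ h; linarith
      · rfl
    exact nonneg_of_mul_nonneg_left h1 (hpos' _)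
  have hXe : ∀ {u v} (h : G.Adj u v), (l - k + 3) * X ⟨s(u, v), h⟩ =
      (l + 1) * (z (.inl u) + z (.inl v)) := by
    intro u v h
    have h1 : X ⟨s(u, v), h⟩ = _ := sum_powerEdge G k z h
    have h2 : (l + 1) * ∑ i, z (.inr (⟨s(u, v), h⟩, i)) = ((k : ℝ) - 2) * X ⟨s(u, v), h⟩ := by
      rw [Finset.mul_sum]
      simp only [hnew]
      simp [Nat.cast_sub (show 2 ≤ k by lia)]
    linear_combination (l + 1) * h1 + h2
  -- The existence of an edge makes the denominator of `pull` positive: both sides of `hXe` are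
  -- positive there.
  have hlk : (k : ℝ) - 3 < l := by
    have h1 := hXe hw0
    have h2 : 0 < (l - k + 3) * X ⟨s(v0, w0), hw0⟩ := by
      rw [h1]; exact mul_pos (by linarith) (add_pos (hpos' _) (hpos' _))
    have h3 : 0 ≤ X ⟨s(v0, w0), hw0⟩ := (hznn _).trans (hle _ (.inl v0) (by simp))
    have := pos_of_mul_pos_left h2 h3
    linarith
  refine ⟨l, fun v => z (.inl v), hlk, fun v => hpos' _, fun u => ?_, ?_⟩
  · rw [heq]
    simp only [inl_mem_powerEdge]
    rw [sum_edges_at G (fun e => X e - z (.inl u)) u]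
    simp only [← SimpleGraph.mem_neighborFinset]
    rw [← Finset.sum_subset (Finset.subset_univ (G.neighborFinset u))]
    · refine Finset.sum_congr rfl fun v hv => ?_
      have hv' := (SimpleGraph.mem_neighborFinset _ _ _).1 hv
      rw [dif_pos hv]
      have h1 := hXe hv'
      have h2 : l - k + 3 ≠ 0 := by linarith
      rw [pull]
      field_simp
      linear_combination h1
    · intro v _ hv
      rw [dif_neg hv]
  · have h1 : l / ((k : ℝ) - 1) = l0 := by
      rw [hl]; field_simp
      exact mul_div_cancel_right₀ _ (by linarith)
    rw [h1, rho]
    convert Matrix.spectralRadius_eq_of_pos_eigenvector _ hsymm hnn (fun i => hpos' i.1) hz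

variable {G k}

/-- This is the symmetry of the matrix aD+bA. -/
theorem sum_neighborFinset_comm [Fintype V] [DecidableRel G.Adj] (a b : ℝ) (x w : V → ℝ) :
    ∑ u, x u * ∑ v ∈ G.neighborFinset u, (a * w u + b * w v) =
      ∑ u, w u * ∑ v ∈ G.neighborFinset u, (a * x u + b * x v) := by
  simp only [Finset.sum_add_distrib, mul_add, Finset.mul_sum]
  congr 1
  · exact Finset.sum_congr rfl fun u _ => Finset.sum_congr rfl fun v _ => by ring
  · simp only [SimpleGraph.neighborFinset_eq_filter, Finset.sum_filter]
    rw [Finset.sum_comm]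
    refine Finset.sum_congr rfl fun u _ => Finset.sum_congr rfl fun v _ => ?_
    simp only [G.adj_comm]
    split_ifs
    · ring
    · rfl

theorem sum_neighborFinset_mono [Fintype V] [DecidableRel G.Adj] {a b : ℝ} (h : a ≤ b)
    {x : V → ℝ} (hx : ∀ v, 0 < x v) (u : V) :
    ∑ v ∈ G.neighborFinset u, (a * x u + (1 + a) * x v) ≤
      ∑ v ∈ G.neighborFinset u, (b * x u + (1 + b) * x v) := by
  refine Finset.sum_le_sum fun v _ => ?_
  have := mul_le_mul_of_nonneg_right h (hx u).le
  have := mul_le_mul_of_nonneg_right h (hx v).le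
  linarith

/-- A strict positive supersolution bounds the eigenvalue of a positive eigenvector from above. -/
theorem lt_of_supersolution [Fintype V] [DecidableRel G.Adj] (hk : 3 ≤ k) {l m : ℝ} {x w : V → ℝ}
    (hm : (k : ℝ) - 3 < m) (hx : ∀ v, 0 < x v)
    (h : ∀ u, l * x u = ∑ v ∈ G.neighborFinset u, (pull k l * x u + (1 + pull k l) * x v))
    (hw : ∀ v, 0 < w v)
    (hle : ∀ u, ∑ v ∈ G.neighborFinset u, (pull k m * w u + (1 + pull k m) * w v) ≤ m * w u)
    (hlt : ∃ u, ∑ v ∈ G.neighborFinset u, (pull k m * w u + (1 + pull k m) * w v) < m * w u) :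
    l < m := by
  -- If m ≤ l, the coefficients at l are at most those at m, so w would remain a strict
  -- supersolution after the change of coefficients. Pairing with x contradicts symmetry.
  by_contra! hc
  have h1 : ∑ u, x u * ∑ v ∈ G.neighborFinset u, (pull k m * w u + (1 + pull k m) * w v) <
      ∑ u, x u * (m * w u) := by
    obtain ⟨u, hu⟩ := hlt
    exact Finset.sum_lt_sum (fun u _ => mul_le_mul_of_nonneg_left (hle u) (hx u).le)
      ⟨u, Finset.mem_univ _, mul_lt_mul_of_pos_left hu (hx u)⟩
  have h2 : ∑ u, w u * (l * x u) ≤ ∑ u, x u * (l * w u) := le_of_eq <|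
    Finset.sum_congr rfl fun u _ => by ring
  have h3 : ∑ u, x u * ∑ v ∈ G.neighborFinset u, (pull k l * w u + (1 + pull k l) * w v) ≤
      ∑ u, x u * ∑ v ∈ G.neighborFinset u, (pull k m * w u + (1 + pull k m) * w v) :=
    Finset.sum_le_sum fun u _ => mul_le_mul_of_nonneg_left
      (sum_neighborFinset_mono (pull_anti hk hm hc) hw u) (hx u).le
  rw [sum_neighborFinset_comm] at h3
  simp only [← h] at h3
  have h4 : ∑ u, x u * (m * w u) ≤ ∑ u, w u * (l * x u) := Finset.sum_le_sum fun u _ => by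
    nlinarith [mul_le_mul_of_nonneg_right hc (mul_pos (hx u) (hw u)).le]
  linarith

/-- A strict positive subsolution bounds the eigenvalue of a positive eigenvector from below. -/
theorem lt_of_subsolution [Fintype V] [DecidableRel G.Adj] (hk : 3 ≤ k) {l m : ℝ} {x w : V → ℝ}
    (hl : (k : ℝ) - 3 < l) (hx : ∀ v, 0 < x v)
    (h : ∀ u, l * x u = ∑ v ∈ G.neighborFinset u, (pull k l * x u + (1 + pull k l) * x v))
    (hw : ∀ v, 0 < w v)
    (hle : ∀ u, m * w u ≤ ∑ v ∈ G.neighborFinset u, (pull k m * w u + (1 + pull k m) * w v))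
    (hlt : ∃ u, m * w u < ∑ v ∈ G.neighborFinset u, (pull k m * w u + (1 + pull k m) * w v)) :
    m < l := by
  -- If l ≤ m, the coefficients at l are at least those at m, and the same pairing applies with the
  -- inequalities reversed.
  by_contra! hc
  have h1 : ∑ u, x u * (m * w u) <
      ∑ u, x u * ∑ v ∈ G.neighborFinset u, (pull k m * w u + (1 + pull k m) * w v) := by
    obtain ⟨u, hu⟩ := hlt
    exact Finset.sum_lt_sum (fun u _ => mul_le_mul_of_nonneg_left (hle u) (hx u).le)
      ⟨u, Finset.mem_univ _, mul_lt_mul_of_pos_left hu (hx u)⟩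
  have h3 : ∑ u, x u * ∑ v ∈ G.neighborFinset u, (pull k m * w u + (1 + pull k m) * w v) ≤
      ∑ u, x u * ∑ v ∈ G.neighborFinset u, (pull k l * w u + (1 + pull k l) * w v) :=
    Finset.sum_le_sum fun u _ => mul_le_mul_of_nonneg_left
      (sum_neighborFinset_mono (pull_anti hk hl hc) hw u) (hx u).le
  rw [sum_neighborFinset_comm (pull k l)] at h3
  simp only [← h] at h3
  have h4 : ∑ u, w u * (l * x u) ≤ ∑ u, x u * (m * w u) := Finset.sum_le_sum fun u _ => by
    nlinarith [mul_le_mul_of_nonneg_right hc (mul_pos (hx u) (hw u)).le]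
  linarith

end Hypergraph

/-! ### The star has the largest spectral radius -/

section

variable {V : Type*} {G : SimpleGraph V}

/-- Two neighbours of `u` are at the same distance from `u`, hence not adjacent in a tree; so their
incidence sets are disjoint subsets of the N-1 edges. -/
theorem SimpleGraph.IsTree.sum_degree_neighborFinset_lt [Fintype V] [DecidableRel G.Adj]
    (hG : G.IsTree) (u : V) : ∑ v ∈ G.neighborFinset u, G.degree v < Fintype.card V := by
  classical
  rw [← hG.card_edgeFinset, Nat.lt_succ_iff]
  simp only [← SimpleGraph.card_incidenceFinset_eq_degree]
  rw [← Finset.card_biUnion]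
  · refine Finset.card_le_card fun e he => ?_
    obtain ⟨v, -, hv⟩ := Finset.mem_biUnion.1 he
    exact G.incidenceFinset_subset v hv
  · intro v hv w hw hvw
    rw [Function.onFun, Finset.disjoint_left]
    intro e he he'
    rw [SimpleGraph.mem_incidenceFinset] at he he'
    have h1 := (Sym2.mem_and_mem_iff hvw).1 ⟨he.2, he'.2⟩
    have h2 : G.Adj v w := by
      have := he.1
      rwa [h1] at this
    rw [Finset.mem_coe, SimpleGraph.mem_neighborFinset] at hv hw
    exact hG.dist_ne_of_adj u h2
      ((SimpleGraph.dist_eq_one_iff_adj.2 hv).trans (SimpleGraph.dist_eq_one_iff_adj.2 hw).symm)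

/-- A connected graph is a star as soon as the neighbours of some vertex have degree one. -/
theorem SimpleGraph.Connected.eq_starGraph [Fintype V] [DecidableRel G.Adj] (hG : G.Connected)
    (c : V) (h : ∀ v, G.Adj c v → G.degree v ≤ 1) : G = SimpleGraph.starGraph c := by
  have h1 : ∀ v w, G.Adj c v → G.Adj v w → w = c := fun v w hv hw =>
    Finset.card_le_one.1 (h v hv) w (by simpa using hw) c (by simpa using hv.symm)
  have h2 : ∀ v, v = c ∨ G.Adj c v := by
    intro v
    obtain ⟨p⟩ := hG.preconnected v c
    induction p with
    | nil => exact .inl rfl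
    | cons hadj p ih =>
      rcases ih h h1 with rfl | h3
      · exact .inr hadj.symm
      · exact .inl (h1 _ _ h3 hadj.symm)
  ext u v
  rw [SimpleGraph.starGraph_adj]
  constructor
  · intro huv
    refine ⟨huv.ne, ?_⟩
    rcases h2 u with rfl | h3
    · exact .inl rfl
    · exact .inr (h1 _ _ h3 huv)
  · rintro ⟨hne, rfl | rfl⟩
    · exact (h2 v).resolve_left hne.symm
    · exact ((h2 u).resolve_left hne).symm

/-- The right side is what the centre of a star on the same number of vertices receives when its
leaves satisfy their equations exactly at `l`. The estimate is made at a vertex where `x` is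
maximal. -/
theorem SimpleGraph.IsTree.eigenvalue_lt_of_not_star [Fintype V] [Nontrivial V]
    [DecidableRel G.Adj] (hG : G.IsTree) (hstar : ∀ c, G ≠ SimpleGraph.starGraph c) {l a b : ℝ}
    (ha : 0 < a) (hb : 0 < b) {x : V → ℝ} (hx : ∀ v, 0 < x v)
    (h : ∀ u, l * x u = ∑ v ∈ G.neighborFinset u, (a * x u + b * x v)) :
    a < l ∧ l < ((Fintype.card V : ℝ) - 1) * (a + b ^ 2 / (l - a)) := by
  classical
  -- Keep only the term of `v` in the equation at `w`; another neighbour of `w` makes the loss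
  -- strict.
  have hnbr : ∀ {v w}, G.Adj v w → b * x v ≤ (l - a) * x w ∧
      (2 ≤ G.degree w → b * x v < (l - a) * x w) := by
    intro v w hvw
    have hmem : v ∈ G.neighborFinset w := by simpa using hvw.symm
    have hp : ∀ z, 0 < a * x w + b * x z := fun z =>
      add_pos (mul_pos ha (hx w)) (mul_pos hb (hx z))
    have h1 := h w
    rw [← Finset.add_sum_erase _ _ hmem] at h1
    constructor
    · have : 0 ≤ ∑ z ∈ (G.neighborFinset w).erase v, (a * x w + b * x z) :=
        Finset.sum_nonneg fun z _ => (hp z).le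
      linarith
    · intro hd
      have : 0 < ∑ z ∈ (G.neighborFinset w).erase v, (a * x w + b * x z) := by
        refine Finset.sum_pos (fun z _ => hp z) ?_
        rw [← Finset.card_pos, Finset.card_erase_of_mem hmem,
          SimpleGraph.card_neighborFinset_eq_degree]
        lia
      linarith
  have hdeg : ∀ v, (l - a * G.degree v) * x v = b * ∑ w ∈ G.neighborFinset v, x w := by
    intro v
    rw [sub_mul, h v, Finset.sum_add_distrib, Finset.sum_const, Finset.mul_sum,
      SimpleGraph.card_neighborFinset_eq_degree, nsmul_eq_mul]
    ring
  obtain ⟨u, hu⟩ := Finite.exists_max x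
  obtain ⟨u1, hu1⟩ := hG.connected.preconnected.exists_adj_of_nontrivial u
  have hla : a < l := by
    have h1 := (hnbr hu1).1
    have h2 := pos_of_mul_pos_left ((mul_pos hb (hx u)).trans_le h1) (hx u1).le
    linarith
  have hla' : 0 < l - a := by linarith
  refine ⟨hla, ?_⟩
  have hpos : ∀ v, 0 < l - a * G.degree v := by
    intro v
    obtain ⟨w, hw⟩ := hG.connected.preconnected.exists_adj_of_nontrivial v
    refine pos_of_mul_pos_left (b := x v) ?_ (hx v).le
    rw [hdeg]
    exact mul_pos hb (Finset.sum_pos (fun z _ => hx z) ⟨w, by simpa using hw⟩)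
  have hsum : ∀ v, (l - a) * ((l - a * G.degree v) * x v) =
      ∑ w ∈ G.neighborFinset v, b * ((l - a) * x w) := by
    intro v
    rw [hdeg, ← Finset.mul_sum, ← Finset.mul_sum]; ring
  have hconst : ∀ v, ∑ w ∈ G.neighborFinset v, b * (b * x v) = b ^ 2 * G.degree v * x v := by
    intro v
    rw [Finset.sum_const, SimpleGraph.card_neighborFinset_eq_degree, nsmul_eq_mul]; ring
  have hB : ∀ v, b ^ 2 * G.degree v ≤ (l - a) * (l - a * G.degree v) := by
    intro v
    refine le_of_mul_le_mul_right ?_ (hx v)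
    rw [mul_assoc (l - a), hsum, ← hconst]
    exact Finset.sum_le_sum fun w hw =>
      mul_le_mul_of_nonneg_left (hnbr (by simpa using hw)).1 hb.le
  have hBs : ∀ v w, G.Adj v w → 2 ≤ G.degree w →
      b ^ 2 * G.degree v < (l - a) * (l - a * G.degree v) := by
    intro v w hvw hw
    refine lt_of_mul_lt_mul_right ?_ (hx v).le
    rw [mul_assoc (l - a), hsum, ← hconst]
    exact Finset.sum_lt_sum (fun w hw =>
      mul_le_mul_of_nonneg_left (hnbr (by simpa using hw)).1 hb.le)
      ⟨w, by simpa using hvw, mul_lt_mul_of_pos_left ((hnbr hvw).2 hw) hb⟩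
  have hone : ∀ {v}, G.Adj u v → 1 ≤ G.degree v := fun {v} hv =>
    Finset.card_pos.2 ⟨u, by simpa using hv.symm⟩
  have hterm : ∀ v, a * x u + b * x v ≤ (a + b ^ 2 * G.degree v / (l - a * G.degree v)) * x u := by
    intro v
    have h1 : (l - a * G.degree v) * x v ≤ b * G.degree v * x u := by
      rw [hdeg, mul_assoc]
      refine mul_le_mul_of_nonneg_left ?_ hb.le
      rw [← SimpleGraph.card_neighborFinset_eq_degree, ← nsmul_eq_mul]
      exact Finset.sum_le_card_nsmul _ _ _ fun z _ => hu z
    have h2 : x v ≤ b * G.degree v * x u / (l - a * G.degree v) := by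
      rw [le_div_iff₀ (hpos v)]; linarith
    have h3 := mul_le_mul_of_nonneg_left h2 hb.le
    calc a * x u + b * x v ≤ a * x u + b * (b * G.degree v * x u / (l - a * G.degree v)) := by
          linarith
      _ = _ := by ring
  -- The gain from replacing a neighbour of degree d by d pendant vertices, factored so that `hB`
  -- and `hBs` give its sign.
  have hgap : ∀ v, G.degree v * (a + b ^ 2 / (l - a)) -
      (a + b ^ 2 * G.degree v / (l - a * G.degree v)) = a * (G.degree v - 1) *
      (((l - a) * (l - a * G.degree v)) - b ^ 2 * G.degree v) /
      ((l - a) * (l - a * G.degree v)) := by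
    intro v
    have h1 := (hpos v).ne'
    have h2 := hla'.ne'
    generalize (G.degree v : ℝ) = d at h1 ⊢
    generalize he : l - a * d = e at h1 ⊢
    generalize hf : l - a = f at h2 ⊢
    field_simp
    rw [← he, ← hf]
    ring
  have hterm' : ∀ v, G.Adj u v → a * x u + b * x v ≤
      (G.degree v * (a + b ^ 2 / (l - a))) * x u := by
    intro v hv
    refine (hterm v).trans (mul_le_mul_of_nonneg_right ?_ (hx u).le)
    have h1 : (1 : ℝ) ≤ G.degree v := by exact_mod_cast hone hv
    rw [← sub_nonneg, hgap]
    exact div_nonneg (mul_nonneg (mul_nonneg ha.le (by linarith)) (sub_nonneg.2 (hB v)))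
      (mul_pos hla' (hpos v)).le
  have hstrict : ∃ v, G.Adj u v ∧ a * x u + b * x v <
      (G.degree v * (a + b ^ 2 / (l - a))) * x u := by
    -- Strictness needs degree at least 2 at `v` and at some neighbour of `v`. Failure of either
    -- would make the tree a star, centred at `u` or at `v`.
    obtain ⟨v, hv, hdv⟩ : ∃ v, G.Adj u v ∧ 2 ≤ G.degree v := by
      by_contra! hc
      exact hstar u (hG.connected.eq_starGraph u fun v hv => Nat.lt_succ_iff.1 (hc v hv))
    obtain ⟨w, hw, hdw⟩ : ∃ w, G.Adj v w ∧ 2 ≤ G.degree w := by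
      by_contra! hc
      exact hstar v (hG.connected.eq_starGraph v fun w hw => Nat.lt_succ_iff.1 (hc w hw))
    refine ⟨v, hv, (hterm v).trans_lt (mul_lt_mul_of_pos_right ?_ (hx u))⟩
    have h1 : (2 : ℝ) ≤ G.degree v := by exact_mod_cast hdv
    rw [← sub_pos, hgap]
    exact div_pos (mul_pos (mul_pos ha (by linarith)) (sub_pos.2 (hBs v w hw hdw)))
      (mul_pos hla' (hpos v))
  have hc : (∑ v ∈ G.neighborFinset u, (G.degree v : ℝ)) ≤ (Fintype.card V : ℝ) - 1 := by
    have := hG.sum_degree_neighborFinset_lt u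
    rw [le_sub_iff_add_le]
    exact_mod_cast this
  refine lt_of_mul_lt_mul_right ?_ (hx u).le
  calc l * x u < ∑ v ∈ G.neighborFinset u, (G.degree v * (a + b ^ 2 / (l - a))) * x u := by
        rw [h u]
        obtain ⟨v, hv, hlt⟩ := hstrict
        exact Finset.sum_lt_sum (fun v hv => hterm' v (by simpa using hv))
          ⟨v, by simpa using hv, hlt⟩
    _ = (∑ v ∈ G.neighborFinset u, (G.degree v : ℝ)) * (a + b ^ 2 / (l - a)) * x u := by
        rw [Finset.sum_mul, Finset.sum_mul]
    _ ≤ _ := by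
        refine mul_le_mul_of_nonneg_right (mul_le_mul_of_nonneg_right hc ?_) (hx u).le
        positivity

namespace Hypergraph

theorem rho_lt_rho_star [Finite V] [Nontrivial V] {k : ℕ} (hk : 3 ≤ k)
    (hG : G.IsTree) (hstar : ∀ c, G ≠ SimpleGraph.starGraph c) (c : V) :
    (graphPower G k).rho < (graphPower (SimpleGraph.starGraph c) k).rho := by
  classical
  let := Fintype.ofFinite V
  obtain ⟨l, x, hl, hx, h, hr⟩ := exists_perron G k hG.connected hk
  obtain ⟨m, y, hm, hy, hm', hr'⟩ := exists_perron (SimpleGraph.starGraph c) k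
    (SimpleGraph.isTree_starGraph c).connected hk
  have ha := pull_pos hk hl
  set a := pull k l
  obtain ⟨hal, hlt⟩ := hG.eigenvalue_lt_of_not_star hstar ha (by linarith : 0 < 1 + a) hx h
  have hk' : (3 : ℝ) ≤ k := by exact_mod_cast hk
  have hal' : 0 < l - a := by linarith
  have hlm : l < m := by
    -- Test vector: 1 at the centre and (1+a)/(l-a) at the leaves, which solves the leaf equations
    -- exactly.
    have hc : ∑ v ∈ (SimpleGraph.starGraph c).neighborFinset c,
        (a * (if c = c then 1 else (1 + a) / (l - a)) +
          (1 + a) * (if v = c then 1 else (1 + a) / (l - a))) =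
        ((Fintype.card V : ℝ) - 1) * (a + (1 + a) ^ 2 / (l - a)) := by
      have h1 : (SimpleGraph.starGraph c).neighborFinset c = Finset.univ.erase c := by
        ext v; simp [eq_comm]
      rw [h1, Finset.sum_congr rfl (g := fun _ => a + (1 + a) ^ 2 / (l - a))]
      · rw [Finset.sum_const, Finset.card_erase_of_mem (Finset.mem_univ _), nsmul_eq_mul,
          Finset.card_univ, Nat.cast_sub Fintype.card_pos, Nat.cast_one]
      · intro v hv
        rw [if_neg (Finset.ne_of_mem_erase hv)]
        simp only [if_true]; ring
    have hv : ∀ u ≠ c, (SimpleGraph.starGraph c).neighborFinset u = {c} := by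
      intro u hu; ext v; simp [SimpleGraph.starGraph_adj, hu]
      rintro rfl; exact hu
    refine lt_of_subsolution (G := SimpleGraph.starGraph c) hk hm hy hm'
      (w := fun v => if v = c then 1 else (1 + a) / (l - a)) ?_ ?_ ⟨c, ?_⟩
    · intro v; split_ifs <;> positivity
    · intro u
      by_cases hu : u = c
      · subst hu
        refine le_of_lt ?_
        rw [hc]; simpa using hlt
      · rw [hv u hu, Finset.sum_singleton, if_neg hu, if_pos rfl]
        refine le_of_eq ?_
        change _ = a * _ + (1 + a) * 1
        field_simp
        ring
    · rw [hc]; simpa using hlt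
  rw [hr, hr', ENNReal.ofReal_lt_ofReal_iff_of_nonneg]
  · exact div_lt_div_of_pos_right hlm (by linarith)
  · exact div_nonneg (by linarith) (by linarith)

end Hypergraph

end

/-! ### Hanging paths: merging two into one lowers the pull -/

/-- The pull of a hanging path with `j` edges on its end, in the eigenvalue equation of
`a • D + b • A` with eigenvalue `c + a`. -/
noncomputable def pathPull (a b c : ℝ) : ℕ → ℝ
  | 0 => 0
  | j + 1 => a + b ^ 2 / (c - pathPull a b c j)

namespace pathPull

variable {a b c : ℝ}

/-- The map g ↦ a + b²/(c-g) is increasing below c; the hypothesis keeps all denominators positive.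
-/
theorem lt_succ (ha : 0 < a) (hb : 0 < b) :
    ∀ {j : ℕ}, (∀ i < j + 1, pathPull a b c i < c) → pathPull a b c j < pathPull a b c (j + 1)
  | 0, h => by
    have h0 := h 0 (by lia)
    have : 0 < c - pathPull a b c 0 := by linarith
    change 0 < a + b ^ 2 / (c - pathPull a b c 0)
    positivity
  | j + 1, h => by
    have ih := lt_succ ha hb (j := j) fun i hi => h i (by lia)
    have h1 := h (j + 1) (by lia)
    rw [pathPull, pathPull.eq_2 a b c (j + 1)]
    have : b ^ 2 / (c - pathPull a b c j) < b ^ 2 / (c - pathPull a b c (j + 1)) :=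
      div_lt_div_of_pos_left (by positivity) (by linarith) (by linarith)
    linarith

theorem gt_of_pos (hb : 0 < b) {j : ℕ} (h : pathPull a b c j < c) :
    a < pathPull a b c (j + 1) := by
  have : 0 < c - pathPull a b c j := by linarith
  rw [pathPull]
  have : 0 < b ^ 2 / (c - pathPull a b c j) := by positivity
  linarith

theorem succ_sub {j : ℕ} (h : pathPull a b c j < c) (h' : pathPull a b c (j + 1) < c) :
    pathPull a b c (j + 2) - pathPull a b c (j + 1) =
      b ^ 2 * (pathPull a b c (j + 1) - pathPull a b c j) /
        ((c - pathPull a b c (j + 1)) * (c - pathPull a b c j)) := by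
  have h1 : c - pathPull a b c j ≠ 0 := by linarith
  have h2 : c - pathPull a b c (j + 1) ≠ 0 := by linarith
  rw [pathPull.eq_2 a b c (j + 1)]
  nth_rw 2 [pathPull.eq_2 a b c j]
  field_simp
  ring

theorem sq_lt_mul {i j : ℕ} (hi : pathPull a b c i < c)
    (h : pathPull a b c (i + 1) + pathPull a b c j < c + a) :
    b ^ 2 < (c - pathPull a b c j) * (c - pathPull a b c i) := by
  rw [pathPull] at h
  rw [← div_lt_iff₀ (by linarith)]
  linarith

/-- Both inequalities amount to b² < (c-g_i)(c-g_j), which is symmetric in i and j. So moving an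
edge from one path to the other preserves the bound. -/
theorem succ_add_lt {i j : ℕ} (hi : pathPull a b c i < c) (hj : pathPull a b c j < c)
    (h : pathPull a b c (i + 1) + pathPull a b c j < c + a) :
    pathPull a b c (j + 1) + pathPull a b c i < c + a := by
  have h1 := sq_lt_mul hi h
  rw [pathPull]
  have : b ^ 2 / (c - pathPull a b c j) < c - pathPull a b c i := by
    rw [div_lt_iff₀ (by linarith)]; linarith
  linarith

/-- By `succ_sub` consecutive increments differ by the factor b²/((c-g_{j+1})(c-g_j)), which need
not be controlled one at a time. The induction strips one increment from each end; the two outer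
factors together are less than 1 because their four denominators, paired crosswise, each give a
product above b². -/
theorem succ_sub_lt (ha : 0 < a) (hb : 0 < b) :
    ∀ (t j : ℕ), (∀ i < j + 1 + t, pathPull a b c i < c) →
      pathPull a b c (j + 1 + t) + pathPull a b c (j + 1) < c + a →
      pathPull a b c (j + 2 + t) - pathPull a b c (j + 1 + t) <
        pathPull a b c (j + 1) - pathPull a b c j := by
  intro t
  induction t using Nat.strong_induction_on with
  | _ t ih =>
  intro j hv h
  have hj := hv j (by lia)
  have hD : 0 < pathPull a b c (j + 1) - pathPull a b c j := by
    have := lt_succ ha hb (j := j) fun i hi => hv i (by lia)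
    linarith
  rcases t with _ | t
  · have hj1 : pathPull a b c (j + 1) < c := by
      have := gt_of_pos (a := a) hb hj
      simp only [add_zero] at h
      linarith
    simp only [add_zero] at h ⊢
    have h1 := sq_lt_mul hj h
    rw [succ_sub hj hj1, div_lt_iff₀ ((by positivity : 0 ≤ b ^ 2).trans_lt h1), mul_comm]
    exact mul_lt_mul_of_pos_left h1 hD
  · have hj1 := hv (j + 1) (by lia)
    have hi := hv (j + 1 + t) (by lia)
    have hi1 : pathPull a b c (j + 1 + (t + 1)) < c := by
      have := gt_of_pos (a := a) hb hj
      linarith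
    have c1 := sq_lt_mul (i := j + 1 + t) (j := j + 1) hi h
    have c2 := sq_lt_mul (i := j) (j := j + 1 + (t + 1)) hj (by linarith)
    have hmid : pathPull a b c (j + 1 + (t + 1)) - pathPull a b c (j + 1 + t) ≤
        pathPull a b c (j + 2) - pathPull a b c (j + 1) := by
      rcases t with _ | t
      · exact le_rfl
      · have := ih t (by lia) (j + 1) (fun i hi => hv i (by lia)) (by
          have h2 := succ_add_lt (i := j + 1 + (t + 1)) (j := j + 1) hi hj1 h
          rw [show j + 1 + 1 + t = j + 1 + (t + 1) by lia]
          linarith)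
        rw [show j + 1 + (t + 1 + 1) = j + 1 + 2 + t by lia,
          show j + 1 + (t + 1) = j + 1 + 1 + t by lia]
        exact this.le
    have e1 := succ_sub (a := a) (b := b) hi hi1
    have e2 := succ_sub (a := a) (b := b) hj hj1
    rw [show j + 2 + (t + 1) = j + 1 + t + 2 by lia]
    change pathPull a b c (j + 1 + t + 2) - pathPull a b c (j + 1 + t + 1) < _
    rw [e1]
    rw [e2] at hmid
    set P := c - pathPull a b c j
    set Q := c - pathPull a b c (j + 1)
    set R := c - pathPull a b c (j + 1 + t)
    set S := c - pathPull a b c (j + 1 + (t + 1)) with hS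
    set D := pathPull a b c (j + 1) - pathPull a b c j
    have hP : 0 < P := by linarith
    have hQ : 0 < Q := by linarith
    have hR : 0 < R := by linarith
    have hS' : 0 < S := by linarith
    change b ^ 2 * (pathPull a b c (j + 1 + (t + 1)) - pathPull a b c (j + 1 + t)) / (S * R) < D
    calc _ ≤ b ^ 2 * (b ^ 2 * D / (Q * P)) / (S * R) := by gcongr
      _ = (b ^ 2 * b ^ 2) * D / ((Q * R) * (S * P)) := by field_simp
      _ < D := by
        rw [div_lt_iff₀ (by positivity), mul_comm]
        exact mul_lt_mul_of_pos_left (mul_lt_mul'' c1 c2 (by positivity) (by positivity)) hD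

/-- Move edges one by one from the shorter path to the longer: `succ_sub_lt` makes each move
decrease the sum of pulls, until the shorter path has length 0 and pull 0. -/
theorem add_le_of_le (ha : 0 < a) (hb : 0 < b) :
    ∀ (j i : ℕ), j ≤ i → (∀ t < i, pathPull a b c t < c) →
      pathPull a b c i + pathPull a b c j < c + a →
      (∀ t < i + j, pathPull a b c t < c) ∧
        pathPull a b c (i + j) ≤ pathPull a b c i + pathPull a b c j ∧
        (1 ≤ j → pathPull a b c (i + j) < pathPull a b c i + pathPull a b c j)
  | 0, i, _, hv, _ => ⟨hv, by simp [pathPull], by simp⟩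
  | j + 1, i, hji, hv, h => by
    have hj := hv j (by lia)
    have hi : pathPull a b c i < c := by
      have := gt_of_pos (a := a) hb hj
      linarith
    have h1 := succ_add_lt hj hi (by linarith)
    obtain ⟨t, rfl⟩ := Nat.exists_eq_add_of_le hji
    have h2 := succ_sub_lt ha hb t j hv h
    rw [show j + 2 + t = j + 1 + t + 1 by lia] at h2
    obtain ⟨ih1, ih2, -⟩ := add_le_of_le ha hb j (j + 1 + t + 1) (by lia) (fun s hs => by
      rcases Nat.lt_succ_iff_lt_or_eq.1 hs with hs | rfl
      exacts [hv s hs, hi]) h1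
    rw [show j + 1 + t + 1 + j = j + 1 + t + (j + 1) by lia] at ih1 ih2
    refine ⟨ih1, ?_, fun _ => ?_⟩ <;> linarith

/-- Replacing two hanging paths at a vertex by a single one of the same total length decreases
the pull. -/
theorem add_lt (ha : 0 < a) (hb : 0 < b) {i j : ℕ} (hi : 1 ≤ i) (hj : 1 ≤ j)
    (hvi : ∀ t < i, pathPull a b c t < c) (hvj : ∀ t < j, pathPull a b c t < c)
    (h : pathPull a b c i + pathPull a b c j < c + a) :
    (∀ t < i + j, pathPull a b c t < c) ∧
      pathPull a b c (i + j) < pathPull a b c i + pathPull a b c j := by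
  rcases le_total j i with hji | hij
  · have := add_le_of_le ha hb j i hji hvi h
    exact ⟨this.1, this.2.2 hj⟩
  · have := add_le_of_le ha hb i j hij hvj (by linarith)
    rw [add_comm i j, add_comm (pathPull a b c i)]
    exact ⟨this.1, this.2.2 hi⟩

theorem sum_le (ha : 0 < a) (hb : 0 < b) {ι : Type*} (S : Finset ι) (s : ι → ℕ) (q : ι → ℝ)
    (hs : ∀ i ∈ S, 1 ≤ s i ∧ (∀ t < s i, pathPull a b c t < c) ∧ pathPull a b c (s i) ≤ q i)
    (hq : ∑ i ∈ S, q i < c + a) :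
    (∀ t < ∑ i ∈ S, s i, pathPull a b c t < c) ∧ pathPull a b c (∑ i ∈ S, s i) ≤ ∑ i ∈ S, q i ∧
      (2 ≤ S.card → pathPull a b c (∑ i ∈ S, s i) < ∑ i ∈ S, q i) := by
  classical
  induction S using Finset.induction_on with
  | empty => simp [pathPull]
  | insert i S hi ih =>
    rw [Finset.sum_insert hi] at hq
    obtain ⟨h1, h2, h3⟩ := hs i (Finset.mem_insert_self i S)
    have hpos : ∀ j ∈ insert i S, 0 < q j := by
      intro j hj
      obtain ⟨h1, h2, h3⟩ := hs j hj
      obtain ⟨t, ht⟩ := Nat.exists_eq_add_of_le' h1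
      have := gt_of_pos (a := a) hb (h2 t (by lia))
      rw [← ht] at this
      linarith
    obtain ⟨ih1, ih2, -⟩ := ih (fun j hj => hs j (Finset.mem_insert_of_mem hj))
      (by have := hpos i (Finset.mem_insert_self i S); linarith)
    rw [Finset.sum_insert hi, Finset.sum_insert hi, Finset.card_insert_of_notMem hi]
    rcases S.eq_empty_or_nonempty with rfl | ⟨j, hj⟩
    · simpa using ⟨h2, h3⟩
    · have hge : 1 ≤ ∑ i ∈ S, s i := (hs j (Finset.mem_insert_of_mem hj)).1.trans
        (Finset.single_le_sum (fun _ _ => Nat.zero_le _) hj)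
      obtain ⟨k1, k2⟩ := add_lt ha hb h1 hge h2 ih1 (by linarith)
      refine ⟨k1, ?_, fun _ => ?_⟩ <;> linarith

end pathPull

/-! ### Rooted trees -/

namespace SimpleGraph

variable {V : Type*} {G : SimpleGraph V}

theorem IsTree.eq_of_adj_of_dist (hG : G.IsTree) {r u v w : V} (hu : G.Adj u w) (hv : G.Adj v w)
    (hdu : G.dist r w = G.dist r u + 1) (hdv : G.dist r w = G.dist r v + 1) : u = v := by
  obtain ⟨p, hp⟩ := hG.connected.exists_walk_length_eq_dist r u
  obtain ⟨q, hq⟩ := hG.connected.exists_walk_length_eq_dist r v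
  have hp' : (p.concat hu).IsPath :=
    Walk.isPath_of_length_eq_dist _ (by rw [Walk.length_concat, hp, hdu])
  have hq' : (q.concat hv).IsPath :=
    Walk.isPath_of_length_eq_dist _ (by rw [Walk.length_concat, hq, hdv])
  have h := congrArg Walk.penultimate ((hG.existsUnique_path r w).unique hp' hq')
  simpa using h

/-- The parent function of a rooted tree. -/
theorem IsTree.exists_parent (hG : G.IsTree) (r : V) : ∃ p : V → V, (∀ v, v ≠ r →
    G.Adj v (p v) ∧ G.dist r v = G.dist r (p v) + 1) ∧
    ∀ u v, G.Adj u v → (u ≠ r ∧ p u = v) ∨ (v ≠ r ∧ p v = u) := by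
  have h : ∀ v, v ≠ r → ∃ u, G.Adj v u ∧ G.dist r v = G.dist r u + 1 := by
    intro v hv
    obtain ⟨p, hp⟩ := hG.connected.exists_walk_length_eq_dist v r
    cases p with
    | nil => exact absurd rfl hv
    | cons hadj p =>
      rename_i u
      refine ⟨u, hadj, ?_⟩
      have h1 := SimpleGraph.dist_le p
      have h2 := hG.dist_eq_dist_add_one_of_adj r hadj
      rw [Walk.length_cons] at hp
      rw [dist_comm] at hp h1
      lia
  choose! p hp using h
  refine ⟨p, hp, fun u v huv => ?_⟩
  have hne : ∀ {u v}, G.dist r u = G.dist r v + 1 → u ≠ r := by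
    rintro u v h rfl; simp at h
  rcases hG.dist_eq_dist_add_one_of_adj r huv with h | h
  · have hu := hne h
    exact .inl ⟨hu, hG.eq_of_adj_of_dist (hp u hu).1.symm huv.symm (hp u hu).2 h⟩
  · have hv := hne h
    exact .inr ⟨hv, hG.eq_of_adj_of_dist (hp v hv).1.symm huv (hp v hv).2 h⟩

end SimpleGraph

theorem exists_subtree_size {V : Type*} [Fintype V] (d : V → ℕ) (ch : V → Finset V)
    (h : ∀ v, ∀ w ∈ ch v, d w = d v + 1) : ∃ s : V → ℕ, ∀ v, s v = 1 + ∑ w ∈ ch v, s w := by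
  obtain ⟨N, hN⟩ : ∃ N, ∀ v, d v ≤ N :=
    ⟨∑ v, d v, fun v => Finset.single_le_sum (fun _ _ => Nat.zero_le _) (Finset.mem_univ v)⟩
  -- Recursion on the remaining depth; at fuel 0 a vertex of depth N has no children, so the value 1
  -- is correct.
  let f : ℕ → V → ℕ := fun n => Nat.rec (fun _ => 1) (fun _ g v => 1 + ∑ w ∈ ch v, g w) n
  refine ⟨fun v => f (N - d v) v, fun v => ?_⟩
  rcases Nat.lt_or_ge (d v) N with hv | hv
  · obtain ⟨t, ht⟩ : ∃ t, N - d v = t + 1 := ⟨N - d v - 1, by lia⟩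
    dsimp only
    rw [ht]
    change 1 + ∑ w ∈ ch v, f t w = _
    congr 1
    refine Finset.sum_congr rfl fun w hw => ?_
    rw [h v w hw, show N - (d v + 1) = t by lia]
  · have h1 : ch v = ∅ := Finset.eq_empty_of_forall_notMem fun w hw => by
      have := h v w hw; have := hN w; lia
    dsimp only
    rw [h1, show N - d v = 0 by lia]
    rfl

/-! ### The path has the smallest spectral radius -/

namespace SimpleGraph

variable {V : Type*} {G : SimpleGraph V}

/-- A tree in which the distance from some vertex is injective is a path. -/
theorem IsTree.nonempty_iso_pathGraph [Fintype V] (hG : G.IsTree) (r : V)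
    (h : Function.Injective (G.dist r)) : Nonempty (G ≃g pathGraph (Fintype.card V)) := by
  have hlt : ∀ v, G.dist r v < Fintype.card V := by
    intro v
    obtain ⟨p, hp⟩ := hG.connected.exists_walk_length_eq_dist r v
    rw [← hp]
    exact (Walk.isPath_of_length_eq_dist _ hp).length_lt
  have hbij : Function.Bijective fun v => (⟨G.dist r v, hlt v⟩ : Fin (Fintype.card V)) := by
    rw [Fintype.bijective_iff_injective_and_card]
    exact ⟨fun u v huv => h (congrArg Fin.val huv), by simp⟩
  obtain ⟨p, hp, -⟩ := hG.exists_parent r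
  have hadj : ∀ u v, G.dist r u + 1 = G.dist r v → G.Adj u v := by
    intro u v huv
    have hv : v ≠ r := by rintro rfl; simp at huv
    have h1 : p v = u := h (by have := (hp v hv).2; lia)
    exact h1 ▸ (hp v hv).1.symm
  refine ⟨⟨Equiv.ofBijective _ hbij, fun {u v} => ?_⟩⟩
  simp only [Equiv.ofBijective_apply, pathGraph_adj]
  constructor
  · rintro (h | h)
    exacts [hadj u v h, (hadj v u h).symm]
  · intro huv
    rcases hG.dist_eq_dist_add_one_of_adj r huv with h | h
    exacts [.inr h.symm, .inl h.symm]

/-- Rooting at a leaf makes the rest of the tree a single branch with N-1 vertices whose pull is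
exactly `l`; comparing it with a path of N-1 edges gives the bound. -/
theorem IsTree.pathPull_lt_or_iso_pathGraph [Fintype V] [Nontrivial V] [DecidableRel G.Adj]
    (hG : G.IsTree) {l a b : ℝ} (ha : 0 < a) (hb : 0 < b) {x : V → ℝ} (hx : ∀ v, 0 < x v)
    (h : ∀ u, l * x u = ∑ v ∈ G.neighborFinset u, (a * x u + b * x v)) :
    ((∀ t < Fintype.card V - 1, pathPull a b (l - a) t < l - a) ∧
      pathPull a b (l - a) (Fintype.card V - 1) < l) ∨
    Nonempty (G ≃g pathGraph (Fintype.card V)) := by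
  classical
  obtain ⟨r, hr⟩ := hG.exists_vert_degree_one_of_nontrivial
  obtain ⟨p, hp, hp'⟩ := hG.exists_parent r
  let ch : V → Finset V := fun v => (Finset.univ.erase r).filter fun w => p w = v
  have hch : ∀ {v w}, w ∈ ch v ↔ w ≠ r ∧ p w = v := by simp [ch]
  obtain ⟨s, hs⟩ := exists_subtree_size (G.dist r) ch fun v w hw => by
    obtain ⟨h1, rfl⟩ := hch.1 hw
    exact (hp w h1).2
  have hsr : s r = Fintype.card V := by
    -- Summing the recursion over all vertices counts each non-root `s w` once, at its parent; what
    -- remains is `s r`.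
    have h1 : ∑ v, s v = Fintype.card V + ∑ v ∈ Finset.univ.erase r, s v := by
      rw [← Finset.sum_fiberwise (Finset.univ.erase r) p s, Finset.sum_congr rfl fun v _ => hs v,
        Finset.sum_add_distrib]
      simp [ch]
    rw [← Finset.add_sum_erase _ _ (Finset.mem_univ r)] at h1
    lia
  have hnbr : ∀ v, v ≠ r → G.neighborFinset v = insert (p v) (ch v) := by
    intro v hv
    ext w
    rw [mem_neighborFinset, Finset.mem_insert, hch]
    constructor
    · intro hvw
      rcases hp' v w hvw with h | h
      exacts [.inl h.2.symm, .inr h]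
    · rintro (rfl | ⟨hw, rfl⟩)
      exacts [(hp v hv).1, (hp w hw).1.symm]
  have hnbrr : G.neighborFinset r = ch r := by
    ext w
    rw [mem_neighborFinset, hch]
    constructor
    · intro hvw
      exact (hp' r w hvw).resolve_left fun h => h.1 rfl
    · rintro ⟨hw, hpw⟩
      have := (hp w hw).1
      rw [hpw] at this; exact this.symm
  have hpv : ∀ v, v ≠ r → p v ∉ ch v := by
    intro v hv hc
    obtain ⟨h1, h2⟩ := hch.1 hc
    have := (hp v hv).2
    have := (hp _ h1).2
    rw [h2] at this
    lia
  -- The pull of the branch at `v` on its parent; the value at `r` is arbitrary and plays no role.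
  let q : V → ℝ := fun v => a + b * x v / x (p v)
  have hqs : ∀ v, ∑ w ∈ ch v, q w = (∑ w ∈ ch v, (a * x v + b * x w)) / x v := by
    intro v
    rw [Finset.sum_div]
    refine Finset.sum_congr rfl fun w hw => ?_
    have := (hx v).ne'
    simp only [q, (hch.1 hw).2]
    field_simp
  have hqr : ∑ w ∈ ch r, q w = l := by
    rw [hqs, ← hnbrr, ← h]
    exact mul_div_cancel_right₀ _ (hx r).ne'
  have hqv : ∀ v, v ≠ r → ∑ w ∈ ch v, q w = (l - a) - b * x (p v) / x v := by
    intro v hv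
    have h1 := h v
    rw [hnbr v hv, Finset.sum_insert (hpv v hv)] at h1
    rw [hqs, eq_sub_of_add_eq' h1.symm]
    have := (hx v).ne'
    field_simp
    ring
  -- Induction on branch size: `sum_le` merges the children's paths into one, and a step of the
  -- recursion adds the edge to the parent. Equality forces at most one child, again with equality.
  have main : ∀ n v, s v = n → v ≠ r → (∀ t < s v, pathPull a b (l - a) t < l - a) ∧
      pathPull a b (l - a) (s v) ≤ q v ∧ (pathPull a b (l - a) (s v) = q v →
        (ch v).card ≤ 1 ∧ ∀ w ∈ ch v, pathPull a b (l - a) (s w) = q w) := by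
    intro n
    induction n using Nat.strong_induction_on with
    | _ n ih =>
    intro v hn hv
    have hsv := hs v
    have hsmall : ∀ w ∈ ch v, s w < n := by
      intro w hw
      have := Finset.single_le_sum (f := s) (fun _ _ => Nat.zero_le _) hw
      lia
    have hqlt : ∑ w ∈ ch v, q w < l - a := by
      rw [hqv v hv]
      have : 0 < b * x (p v) / x v := div_pos (mul_pos hb (hx _)) (hx _)
      linarith
    obtain ⟨h1, h2, h3⟩ := pathPull.sum_le ha hb (ch v) s q (c := l - a) (fun w hw => by
      have := ih (s w) (hsmall w hw) w rfl (hch.1 hw).1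
      refine ⟨by rw [hs w]; lia, this.1, this.2.1⟩) (by linarith)
    rw [add_comm] at hsv
    set S := ∑ w ∈ ch v, s w with hS
    have hSl : pathPull a b (l - a) S < l - a := h2.trans_lt hqlt
    have hpos : 0 < b * x (p v) / x v := div_pos (mul_pos hb (hx _)) (hx _)
    have hqe : q v = a + b ^ 2 / (b * x (p v) / x v) := by
      have := (hx v).ne'
      have := (hx (p v)).ne'
      simp only [q]
      field_simp
    rw [hsv, pathPull, hqe]
    refine ⟨fun t ht => ?_, ?_, fun heq => ?_⟩
    · rcases Nat.lt_succ_iff_lt_or_eq.1 ht with ht | rfl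
      exacts [h1 t ht, hSl]
    · have : b ^ 2 / (l - a - pathPull a b (l - a) S) ≤ b ^ 2 / (b * x (p v) / x v) := by
        refine div_le_div_of_nonneg_left (by positivity) hpos ?_
        rw [hqv v hv] at h2
        linarith
      linarith
    · have heq' : pathPull a b (l - a) S = ∑ w ∈ ch v, q w := by
        have h4 := add_left_cancel heq
        rw [div_eq_div_iff (by linarith) hpos.ne'] at h4
        have h4 := mul_left_cancel₀ (by positivity) h4
        rw [hqv v hv]
        linarith
      have hcard : (ch v).card ≤ 1 := by
        by_contra! hc
        exact (h3 hc).ne heq'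
      refine ⟨hcard, fun w hw => ?_⟩
      have h5 : ch v = {w} := Finset.eq_singleton_iff_unique_mem.2
        ⟨hw, fun z hz => Finset.card_le_one.1 hcard z hz w hw⟩
      rw [hS, h5, Finset.sum_singleton, Finset.sum_singleton] at heq'
      exact heq'
  obtain ⟨c0, hc0⟩ : ∃ c0, ch r = {c0} := by
    rw [← Finset.card_eq_one, ← hnbrr, card_neighborFinset_eq_degree, hr]
  have hc0r : c0 ≠ r := (hch.1 (hc0 ▸ Finset.mem_singleton_self c0)).1
  have hsc0 : s c0 = Fintype.card V - 1 := by
    rw [← hsr, hs r, hc0, Finset.sum_singleton]; lia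
  rw [hc0, Finset.sum_singleton] at hqr
  obtain ⟨m1, m2, m3⟩ := main _ c0 rfl hc0r
  rw [hsc0, hqr] at m2
  rw [hsc0] at m1
  rcases m2.lt_or_eq with hlt | heq
  · exact .inl ⟨m1, hlt⟩
  · right
    -- Equality at the child of the root passes down to all branches, so nothing branches and each
    -- distance from `r` occurs once.
    have heqc : ∀ n v, G.dist r v = n → v ≠ r → pathPull a b (l - a) (s v) = q v := by
      intro n
      induction n with
      | zero =>
        intro v hv hvr
        exact absurd (hG.connected.dist_eq_zero_iff.1 hv).symm hvr
      | succ n ih =>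
        intro v hv hvr
        by_cases hpr : p v = r
        · have : v ∈ ch r := hch.2 ⟨hvr, hpr⟩
          rw [hc0, Finset.mem_singleton] at this
          rw [this, hsc0, heq, hqr]
        · have h1 := ih (p v) (by have := (hp v hvr).2; lia) hpr
          exact ((main _ (p v) rfl hpr).2.2 h1).2 v (hch.2 ⟨hvr, rfl⟩)
    have hcard : ∀ v, (ch v).card ≤ 1 := by
      intro v
      by_cases hv : v = r
      · rw [hv, hc0, Finset.card_singleton]
      · exact ((main _ v rfl hv).2.2 (heqc _ v rfl hv)).1
    have hinj : ∀ n u v, G.dist r u = n → G.dist r v = n → u = v := by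
      intro n
      induction n with
      | zero =>
        intro u v hu hv
        rw [← hG.connected.dist_eq_zero_iff.1 hu, ← hG.connected.dist_eq_zero_iff.1 hv]
      | succ n ih =>
        intro u v hu hv
        have hur : u ≠ r := by rintro rfl; simp at hu
        have hvr : v ≠ r := by rintro rfl; simp at hv
        have h1 : p u = p v := ih _ _ (by have := (hp u hur).2; lia)
          (by have := (hp v hvr).2; lia)
        exact Finset.card_le_one.1 (hcard (p v)) u (hch.2 ⟨hur, h1⟩) v (hch.2 ⟨hvr, rfl⟩)
    exact hG.nonempty_iso_pathGraph r fun u v huv => hinj _ u v huv rfl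

theorem sum_neighborFinset_pathGraph {n : ℕ} [DecidableRel (pathGraph n).Adj] (F : ℕ → ℝ)
    (i : Fin n) : ∑ v ∈ (pathGraph n).neighborFinset i, F v =
      (if 0 < (i : ℕ) then F (i - 1) else 0) + if (i : ℕ) + 1 < n then F (i + 1) else 0 := by
  rw [neighborFinset_eq_filter, Finset.sum_filter]
  have h1 : ∀ v : Fin n, (if (pathGraph n).Adj i v then F v else 0) =
      (if (v : ℕ) + 1 = i then F v else 0) + if (i : ℕ) + 1 = v then F v else 0 := by
    intro v
    rw [if_congr pathGraph_adj rfl rfl]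
    split_ifs <;> first | (exfalso; lia) | simp
  simp only [h1, Finset.sum_add_distrib]
  congr 1
  · rw [Fin.sum_univ_eq_sum_range (fun v => if v + 1 = (i : ℕ) then F v else 0) n]
    split_ifs with hi
    · rw [Finset.sum_eq_single_of_mem ((i : ℕ) - 1) (by have := i.2; simp; lia)]
      · rw [if_pos (by lia)]
      · intro v _ hv; rw [if_neg (by lia)]
    · exact Finset.sum_eq_zero fun v _ => if_neg (by lia)
  · rw [Fin.sum_univ_eq_sum_range (fun v => if (i : ℕ) + 1 = v then F v else 0) n]
    rw [Finset.sum_ite_eq]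
    simp

end SimpleGraph

namespace Hypergraph

variable {V : Type*} {G : SimpleGraph V}

theorem rho_path_lt_rho [Fintype V] [Nontrivial V] {k : ℕ} (hk : 3 ≤ k) (hG : G.IsTree)
    (hpath : IsEmpty (G ≃g SimpleGraph.pathGraph (Fintype.card V))) :
    (graphPower (SimpleGraph.pathGraph (Fintype.card V)) k).rho < (graphPower G k).rho := by
  classical
  obtain ⟨n, hn⟩ : ∃ n, Fintype.card V = n + 2 :=
    ⟨Fintype.card V - 2, by have := Fintype.one_lt_card (α := V); lia⟩
  obtain ⟨l, x, hl, hx, h, hr⟩ := exists_perron G k hG.connected hk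
  have ha := pull_pos hk hl
  have hlt := hG.pathPull_lt_or_iso_pathGraph ha (by linarith : 0 < 1 + pull k l) hx h
  rw [or_iff_left (not_nonempty_iff.2 hpath)] at hlt
  rw [hn] at hlt ⊢
  obtain ⟨m, y, hm, hy, hm', hr'⟩ := exists_perron (SimpleGraph.pathGraph (n + 2)) k
    (SimpleGraph.pathGraph_connected _) hk
  set a := pull k l
  have hk' : (3 : ℝ) ≤ k := by exact_mod_cast hk
  have hlm : m < l := by
    obtain ⟨hv, hlast⟩ := hlt
    rw [show n + 2 - 1 = n + 1 by lia] at hv hlast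
    set g := pathPull a (1 + a) (l - a) with hg
    -- Chosen so that every path equation but the last holds exactly at `l`; `hback` identifies the
    -- contribution from behind as g_j·w_j, and at the end g_{n+1} < l makes it strict.
    let w : ℕ → ℝ := fun n => Nat.rec 1 (fun j wj => (l - a - g j) / (1 + a) * wj) n
    have hw : ∀ j, w (j + 1) = (l - a - g j) / (1 + a) * w j := fun j => rfl
    have hwpos : ∀ j ≤ n + 1, 0 < w j := by
      intro j
      induction j with
      | zero => intro _; exact one_pos
      | succ j ih =>
        intro hj
        rw [hw]
        have := hv j (by lia)
        exact mul_pos (div_pos (by linarith) (by linarith)) (ih (by lia))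
    have hback : ∀ j ≤ n + 1, (if 0 < j then a * w j + (1 + a) * w (j - 1) else 0) =
        g j * w j := by
      intro j hj
      rcases j with _ | j
      · simp [hg, pathPull]
      · have h1 : g (j + 1) = a + (1 + a) ^ 2 / (l - a - g j) := rfl
        have h2 : l - a - g j ≠ 0 := by have := hv j (by lia); linarith
        rw [if_pos (by lia), h1, Nat.add_sub_cancel, hw]
        have : 1 + a ≠ 0 := by linarith
        field_simp
    have hsum : ∀ i : Fin (n + 2), ∑ v ∈ (SimpleGraph.pathGraph (n + 2)).neighborFinset i,
        (a * w i + (1 + a) * w v) =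
        g i * w i + if (i : ℕ) + 1 < n + 2 then a * w i + (1 + a) * w (i + 1) else 0 := by
      intro i
      rw [SimpleGraph.sum_neighborFinset_pathGraph (fun v => a * w i + (1 + a) * w v),
        hback i (by lia)]
    have hend : ∑ v ∈ (SimpleGraph.pathGraph (n + 2)).neighborFinset (Fin.last (n + 1)),
        (a * w (Fin.last (n + 1)) + (1 + a) * w v) < l * w (Fin.last (n + 1)) := by
      rw [hsum, if_neg (by simp), add_zero, Fin.val_last]
      exact mul_lt_mul_of_pos_right hlast (hwpos _ le_rfl)
    refine lt_of_supersolution (G := SimpleGraph.pathGraph (n + 2)) hk hl hy hm'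
      (w := fun v => w v) (fun v => hwpos v (by lia)) (fun i => ?_) ⟨_, hend⟩
    by_cases hi : (i : ℕ) + 1 < n + 2
    · refine le_of_eq ?_
      change ∑ v ∈ (SimpleGraph.pathGraph (n + 2)).neighborFinset i,
        (a * w i + (1 + a) * w v) = _
      rw [hsum, if_pos hi, hw]
      have : 1 + a ≠ 0 := by linarith
      field_simp
      ring
    · have : i = Fin.last (n + 1) := Fin.ext (by simp; lia)
      rw [this]
      exact hend.le
  have : 0 ≤ m := by linarith
  rw [hr, hr', ENNReal.ofReal_lt_ofReal_iff_of_nonneg]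
  · exact div_lt_div_of_pos_right hlm (by linarith)
  · exact div_nonneg (by linarith) (by linarith)

end Hypergraph

/-! ### Labellings by the superstar and the hyperpath -/

namespace Hypergraph

variable {V : Type*} {G : SimpleGraph V}

theorem _root_.SimpleGraph.IsTree.natCard_graphPower [Finite V] (hG : G.IsTree) {k : ℕ}
    (hk : 3 ≤ k) : Nat.card (V ⊕ (G.edgeSet × Fin (k - 2))) = (Nat.card V - 1) * (k - 1) + 1 := by
  classical
  let := Fintype.ofFinite V
  have h1 := hG.card_edgeFinset
  rw [SimpleGraph.edgeFinset_card] at h1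
  rw [Nat.card_sum, Nat.card_prod, Nat.card_eq_fintype_card, Nat.card_eq_fintype_card,
    Nat.card_eq_fintype_card, Fintype.card_fin, ← h1, Nat.add_sub_cancel]
  obtain ⟨t, rfl⟩ := Nat.exists_eq_add_of_le' (show 2 ≤ k by omega)
  simp only [Nat.add_sub_cancel, show t + 2 - 1 = t + 1 by omega]
  ring

/-- A labelling of the vertices of `graphPower G k` by `0, …, n - 1` that carries the edges onto the
sets `F 0, …, F (m - 1)` is an isomorphism. -/
theorem graphPower_isomorphic [Finite V] {k m n : ℕ} (H : Hypergraph (Fin n))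
    (hH : ∀ v, v ∈ H.vertexSet) (hn : Nat.card (V ⊕ (G.edgeSet × Fin (k - 2))) = n)
    (F : ℕ → Set (Fin n)) (hF : H.edgeSet = {e | ∃ i < m, e = F i})
    (f : V ⊕ (G.edgeSet × Fin (k - 2)) → Fin n) (s : G.edgeSet → Fin m)
    (hs : Function.Surjective s) (hf : ∀ e, f '' powerEdge G k e = F (s e))
    (hcov : ∀ v, v ∈ Set.range f ∨ ∃ i < m, v ∈ F i) :
    (graphPower G k).Isomorphic H := by
  classical
  let := Fintype.ofFinite V
  -- The vertex counts agree, so surjectivity, which follows from covering by edges, already gives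
  -- bijectivity.
  have hsurj : Function.Surjective f := by
    intro v
    rcases hcov v with h | ⟨i, hi, h⟩
    · exact h
    · obtain ⟨e, he⟩ := hs ⟨i, hi⟩
      have : v ∈ f '' powerEdge G k e := by rw [hf, he]; exact h
      obtain ⟨a, -, ha⟩ := this
      exact ⟨a, ha⟩
  refine isomorphic_of_bijective (fun a => Set.mem_univ a) hH (powerEdge G k)
    (fun i : Fin m => F i) (graphPower_edgeSet G k) ?_ f ?_ s hs hf
  · rw [hF]; ext e; constructor
    · rintro ⟨i, hi, rfl⟩; exact ⟨⟨i, hi⟩, rfl⟩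
    · rintro ⟨i, rfl⟩; exact ⟨i, i.2, rfl⟩
  · rw [Fintype.bijective_iff_surjective_and_card]
    exact ⟨hsurj, by rw [← Nat.card_eq_fintype_card, hn, Fintype.card_fin]⟩

theorem graphPower_starGraph_isomorphic [Finite V] (c : V) {k n : ℕ} (hk : 3 ≤ k)
    (hn : Nat.card (V ⊕ ((SimpleGraph.starGraph c).edgeSet × Fin (k - 2))) = n) :
    (graphPower (SimpleGraph.starGraph c) k).Isomorphic (superstar n k) := by
  classical
  let := Fintype.ofFinite V
  have hN := (SimpleGraph.isTree_starGraph c).natCard_graphPower hk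
  rw [hn] at hN
  set m := Nat.card V - 1 with hm
  have hdiv : (n - 1) / (k - 1) = m := by
    rw [hN, Nat.add_sub_cancel, Nat.mul_div_cancel _ (by omega)]
  let τ : {v : V // v ≠ c} ≃ Fin m := Fintype.equivFinOfCardEq (by
    rw [Fintype.card_subtype_compl, Fintype.card_subtype_eq, hm, Nat.card_eq_fintype_card])
  have hleaf : ∀ e : (SimpleGraph.starGraph c).edgeSet, ∃ v : {v : V // v ≠ c},
      e.val = s(c, v.val) := by
    rintro ⟨⟨x, y⟩, h⟩
    obtain ⟨hne, rfl | rfl⟩ := SimpleGraph.starGraph_adj.1 h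
    exacts [⟨⟨y, hne.symm⟩, rfl⟩, ⟨⟨x, hne⟩, Sym2.eq_swap⟩]
  choose leaf hleaf using hleaf
  have hbd : ∀ (i : Fin m) (t : ℕ), t ≤ k - 1 → i * (k - 1) + t < n := by
    intro i t ht
    have h1 : ((i : ℕ) + 1) * (k - 1) ≤ m * (k - 1) := Nat.mul_le_mul_right _ i.2
    rw [Nat.succ_mul] at h1
    omega
  -- The centre gets 0; the i-th leaf and the new vertices of its edge fill the block from i(k-1)+1
  -- to (i+1)(k-1).
  let f : V ⊕ ((SimpleGraph.starGraph c).edgeSet × Fin (k - 2)) → Fin n := Sum.elim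
    (fun v => if h : v = c then ⟨0, by omega⟩ else ⟨τ ⟨v, h⟩ * (k - 1) + 1, hbd _ _ (by omega)⟩)
    (fun p => ⟨τ (leaf p.1) * (k - 1) + (p.2 + 2), hbd _ _ (by omega)⟩)
  have hfc : f (.inl c) = ⟨0, by omega⟩ := dif_pos rfl
  have hfv : ∀ v : {v : V // v ≠ c}, f (.inl v) = ⟨τ v * (k - 1) + 1, hbd _ _ (by omega)⟩ :=
    fun v => dif_neg v.2
  have hfp : ∀ p, f (.inr p) = ⟨τ (leaf p.1) * (k - 1) + (p.2 + 2), hbd _ _ (by omega)⟩ :=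
    fun p => rfl
  refine graphPower_isomorphic (m := m) (superstar n k) (fun v => Set.mem_univ v) hn
    (fun i => {v : Fin n | v.val = 0 ∨ (i * (k - 1) < v.val ∧ v.val ≤ (i + 1) * (k - 1))})
    (by rw [← hdiv]; rfl) f (fun e => τ (leaf e)) ?_ ?_ ?_
  · intro i
    obtain ⟨v, rfl⟩ := τ.surjective i
    have hadj : (SimpleGraph.starGraph c).Adj c v.val :=
      SimpleGraph.starGraph_adj.2 ⟨v.2.symm, .inl rfl⟩
    refine ⟨⟨s(c, v.val), hadj⟩, ?_⟩
    have h1 := hleaf ⟨s(c, v.val), hadj⟩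
    rw [Sym2.congr_right] at h1
    exact congrArg τ (Subtype.ext h1.symm)
  · intro e
    ext x
    simp only [Set.mem_image, Set.mem_ofPred_eq, Nat.succ_mul]
    constructor
    · rintro ⟨a | p, ha, rfl⟩
      · rw [inl_mem_powerEdge, hleaf, Sym2.mem_iff] at ha
        rcases ha with rfl | rfl
        · rw [hfc]; exact .inl rfl
        · rw [hfv]; right; dsimp only; omega
      · rw [inr_mem_powerEdge] at ha
        rw [hfp, ha]; right; dsimp only; omega
    · rintro (hx | ⟨h1, h2⟩)
      · exact ⟨.inl c, by rw [inl_mem_powerEdge, hleaf]; simp, by rw [hfc]; exact Fin.ext hx.symm⟩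
      · rcases Nat.lt_or_ge (τ (leaf e) * (k - 1) + 1) x with h3 | h3
        · refine ⟨.inr (e, ⟨x - (τ (leaf e) * (k - 1) + 2), by omega⟩), by simp, ?_⟩
          rw [hfp]; apply Fin.ext; dsimp only; omega
        · refine ⟨.inl (leaf e), by rw [inl_mem_powerEdge, hleaf]; simp, ?_⟩
          rw [hfv]; apply Fin.ext; dsimp only; omega
  · intro x
    by_cases hx : x.val = 0
    · exact .inl ⟨.inl c, by rw [hfc]; exact Fin.ext hx.symm⟩
    -- The shift by 1 puts a multiple of k-1 into the block that it ends.
    · refine .inr ⟨(x.val - 1) / (k - 1), ?_, .inr ?_⟩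
      · rw [Nat.div_lt_iff_lt_mul (by omega)]; have := x.2; omega
      · have h1 := Nat.div_add_mod' (x.val - 1) (k - 1)
        have h2 := Nat.mod_lt (x.val - 1) (show 0 < k - 1 by omega)
        rw [Nat.succ_mul]
        omega

theorem graphPower_isomorphic_hyperpath [Finite V] (hG : G.IsTree)
    (φ : G ≃g SimpleGraph.pathGraph (Nat.card V)) {k n : ℕ} (hk : 3 ≤ k)
    (hn : Nat.card (V ⊕ (G.edgeSet × Fin (k - 2))) = n) :
    (graphPower G k).Isomorphic (hyperpath n k) := by
  classical
  have hN := hG.natCard_graphPower hk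
  rw [hn] at hN
  have hpos : 0 < Nat.card V := by
    have := hG.connected.nonempty
    exact Nat.card_pos
  set m := Nat.card V - 1 with hm
  have hdiv : (n - 1) / (k - 1) = m := by
    rw [hN, Nat.add_sub_cancel, Nat.mul_div_cancel _ (by omega)]
  have hends : ∀ e : G.edgeSet, ∃ (u v : V), e.val = s(u, v) ∧ (φ u).val + 1 = (φ v).val := by
    rintro ⟨⟨x, y⟩, h⟩
    rcases SimpleGraph.pathGraph_adj.1 (φ.map_adj_iff.2 h) with h | h
    exacts [⟨x, y, rfl, h⟩, ⟨y, x, Sym2.eq_swap, h⟩]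
  choose u v huv hφ using hends
  have hbd : ∀ i < m, ∀ t ≤ k - 1, i * (k - 1) + t < n := by
    intro i hi t ht
    have h1 : (i + 1) * (k - 1) ≤ m * (k - 1) := Nat.mul_le_mul_right _ hi
    rw [Nat.succ_mul] at h1
    omega
  have hum : ∀ e, (φ (u e)).val < m := fun e => by have := hφ e; have := (φ (v e)).2; omega
  have hvn : ∀ w, (φ w).val * (k - 1) < n := fun w => by
    have h1 : (φ w).val * (k - 1) ≤ m * (k - 1) :=
      Nat.mul_le_mul_right _ (by have := (φ w).2; omega)
    omega
  -- Path vertices go to multiples of k-1, and the new vertices of an edge strictly between its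
  -- ends, counted from the lower end `u`.
  let f : V ⊕ (G.edgeSet × Fin (k - 2)) → Fin n := Sum.elim
    (fun w => ⟨(φ w).val * (k - 1), hvn w⟩)
    (fun p => ⟨(φ (u p.1)).val * (k - 1) + (p.2 + 1), hbd _ (hum _) _ (by omega)⟩)
  have hfv : ∀ w, (f (.inl w)).val = (φ w).val * (k - 1) := fun w => rfl
  have hfp : ∀ p, (f (.inr p)).val = (φ (u p.1)).val * (k - 1) + (p.2 + 1) := fun p => rfl
  refine graphPower_isomorphic (m := m) (hyperpath n k) (fun v => Set.mem_univ v) hn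
    (fun i => {v : Fin n | i * (k - 1) ≤ v.val ∧ v.val ≤ (i + 1) * (k - 1)})
    (by rw [← hdiv]; rfl) f (fun e => ⟨φ (u e), hum e⟩) ?_ ?_ ?_
  · intro i
    have hadj : G.Adj (φ.symm ⟨i, by omega⟩) (φ.symm ⟨i + 1, by omega⟩) := by
      rw [φ.symm.map_adj_iff, SimpleGraph.pathGraph_adj]; exact .inl rfl
    refine ⟨⟨s(φ.symm ⟨i, by omega⟩, φ.symm ⟨i + 1, by omega⟩), hadj⟩, Fin.ext ?_⟩
    have h1 := hφ ⟨s(φ.symm ⟨i, by omega⟩, φ.symm ⟨i + 1, by omega⟩), hadj⟩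
    have h2 := huv ⟨s(φ.symm ⟨i, by omega⟩, φ.symm ⟨i + 1, by omega⟩), hadj⟩
    rcases Sym2.eq_iff.1 h2 with ⟨h3, h4⟩ | ⟨h3, h4⟩
    · dsimp only
      rw [← h3, φ.apply_symm_apply]
    · rw [← h3, ← h4, φ.apply_symm_apply, φ.apply_symm_apply] at h1
      dsimp only at h1
      omega
  · intro e
    have hsucc : (φ (v e)).val * (k - 1) = (φ (u e)).val * (k - 1) + (k - 1) := by
      rw [← hφ e, Nat.succ_mul]
    ext x
    simp only [Set.mem_image, Set.mem_ofPred_eq, Nat.succ_mul]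
    constructor
    · rintro ⟨a | p, ha, rfl⟩
      · rw [inl_mem_powerEdge, huv, Sym2.mem_iff] at ha
        rcases ha with rfl | rfl
        · rw [hfv]; omega
        · rw [hfv]; omega
      · rw [inr_mem_powerEdge] at ha
        rw [hfp, ha]; omega
    · rintro ⟨h1, h2⟩
      rcases Nat.eq_or_lt_of_le h1 with h1 | h1
      · exact ⟨.inl (u e), by rw [inl_mem_powerEdge, huv]; simp, Fin.ext (by rw [hfv]; omega)⟩
      rcases Nat.eq_or_lt_of_le h2 with h2 | h2
      · exact ⟨.inl (v e), by rw [inl_mem_powerEdge, huv]; simp, Fin.ext (by rw [hfv]; omega)⟩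
      · refine ⟨.inr (e, ⟨x - ((φ (u e)).val * (k - 1) + 1), by omega⟩), by simp, Fin.ext ?_⟩
        rw [hfp]; dsimp only; omega
  · intro x
    by_cases hx : x.val = 0
    · exact .inl ⟨.inl (φ.symm ⟨0, hpos⟩), Fin.ext (by rw [hfv, φ.apply_symm_apply]; simp [hx])⟩
    · refine .inr ⟨(x.val - 1) / (k - 1), ?_, ?_⟩
      · rw [Nat.div_lt_iff_lt_mul (by omega)]; have := x.2; omega
      · have h1 := Nat.div_add_mod' (x.val - 1) (k - 1)
        have h2 := Nat.mod_lt (x.val - 1) (show 0 < k - 1 by omega)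
        rw [Set.mem_ofPred_eq, Nat.succ_mul]
        omega

end Hypergraph

/-! ### Conclusion -/

theorem SimpleGraph.isTree_pathGraph (m : ℕ) : (SimpleGraph.pathGraph (m + 1)).IsTree := by
  rw [SimpleGraph.isTree_iff_connected_and_card]
  refine ⟨SimpleGraph.pathGraph_connected m, ?_⟩
  have h : Function.Bijective fun i : Fin m => (⟨s(i.castSucc, i.succ),
      SimpleGraph.pathGraph_adj.2 (.inl (by simp))⟩ : (SimpleGraph.pathGraph (m + 1)).edgeSet) := by
    constructor
    · intro i j hij
      rcases Sym2.eq_iff.1 (congrArg Subtype.val hij) with ⟨h1, -⟩ | ⟨h1, h2⟩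
      · exact Fin.castSucc_injective _ h1
      · have h1 := congrArg Fin.val h1
        have h2 := congrArg Fin.val h2
        simp only [Fin.val_castSucc, Fin.val_succ] at h1 h2
        omega
    · rintro ⟨⟨u, v⟩, huv⟩
      rcases SimpleGraph.pathGraph_adj.1 huv with h | h <;> dsimp only at h
      · exact ⟨⟨u, by omega⟩, Subtype.ext (Sym2.eq_iff.2 (.inl ⟨rfl, Fin.ext h⟩))⟩
      · exact ⟨⟨v, by omega⟩, Subtype.ext (Sym2.eq_iff.2 (.inr ⟨rfl, Fin.ext h⟩))⟩
  rw [← Nat.card_congr (Equiv.ofBijective _ h)]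
  simp

theorem corollary1p4 {V : Type*} [Finite V] (T : SimpleGraph V) (hT : T.IsTree)
    (k n : ℕ) (hk : 3 ≤ k) (hn : (Hypergraph.graphPower T k).vertexSet.ncard = n) :
    ((Hypergraph.graphPower T k).rho ≤ (Hypergraph.superstar n k).rho ∧
      ((Hypergraph.graphPower T k).rho = (Hypergraph.superstar n k).rho ↔
        (Hypergraph.graphPower T k).Isomorphic (Hypergraph.superstar n k))) ∧
    ((Hypergraph.hyperpath n k).rho ≤ (Hypergraph.graphPower T k).rho ∧
      ((Hypergraph.hyperpath n k).rho = (Hypergraph.graphPower T k).rho ↔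
        (Hypergraph.graphPower T k).Isomorphic (Hypergraph.hyperpath n k))) := by
  classical
  let := Fintype.ofFinite V
  have hn' : Nat.card (V ⊕ (T.edgeSet × Fin (k - 2))) = n := by
    rw [← hn]; exact (Set.ncard_univ _).symm
  have := hT.connected.nonempty
  constructor
  · by_cases hstar : ∃ c, T = SimpleGraph.starGraph c
    · obtain ⟨c, rfl⟩ := hstar
      have h := Hypergraph.graphPower_starGraph_isomorphic c hk hn'
      exact ⟨h.rho_eq.le, fun _ => h, fun h => h.rho_eq⟩
    · push Not at hstar
      have hV : Nontrivial V := by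
        rw [← not_subsingleton_iff_nontrivial]
        intro _
        exact hstar (Classical.arbitrary V) (Subsingleton.elim _ _)
      let c : V := Classical.arbitrary V
      have hlt := Hypergraph.rho_lt_rho_star hk hT hstar c
      rw [(Hypergraph.graphPower_starGraph_isomorphic c hk (n := n) (by
        rw [← hn', hT.natCard_graphPower hk,
          (SimpleGraph.isTree_starGraph c).natCard_graphPower hk])).rho_eq] at hlt
      exact ⟨hlt.le, fun h => absurd h hlt.ne, fun h => h.rho_eq⟩
  · by_cases hpath : Nonempty (T ≃g SimpleGraph.pathGraph (Nat.card V))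
    · obtain ⟨φ⟩ := hpath
      have h := Hypergraph.graphPower_isomorphic_hyperpath hT φ hk hn'
      exact ⟨h.rho_eq.ge, fun _ => h, fun h => h.rho_eq.symm⟩
    · have hV : Nontrivial V := by
        rw [← not_subsingleton_iff_nontrivial]
        intro _
        rw [Nat.card_eq_fintype_card] at hpath
        exact hpath (hT.nonempty_iso_pathGraph (Classical.arbitrary V)
          fun _ _ _ => Subsingleton.elim _ _)
      rw [not_nonempty_iff, Nat.card_eq_fintype_card] at hpath
      have hlt := Hypergraph.rho_path_lt_rho hk hT hpath
      obtain ⟨m, hm⟩ := Nat.exists_eq_add_of_le' (Fintype.card_pos (α := V))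
      have htree := SimpleGraph.isTree_pathGraph m
      rw [← show _ = m + 1 from hm] at htree
      have h := Hypergraph.graphPower_isomorphic_hyperpath htree
        (by rw [Nat.card_fin]) hk (n := n) (by
          rw [← hn', hT.natCard_graphPower hk, htree.natCard_graphPower hk, Nat.card_fin,
            Nat.card_eq_fintype_card])
      rw [h.rho_eq] at hlt
      exact ⟨hlt.le, fun h => absurd h hlt.ne, fun h => h.rho_eq.symm⟩
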